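/- Let $H$ be a real Hilbert space and $A:H\to 2^H$ a maximal monotone operator with zero set $S=A^{-1}(0)\neq\emptyset$; for $\sigma>0$ let $J_\sigma=(I+\sigma A)^{-1}$ be its resolvent. Let $u,z_0\in H$, $(e_n)\subset H$, $(c_n)\subset(0,\infty)$, $(\lambda_n),(\delta_n)\subset(0,1)$, $(\gamma_n)\subset[0,1)$ with $\lambda_n+\gamma_n+\delta_n=1$, and let $$z_{n+1}=\lambda_nu+\gamma_nz_n+\delta_nJ_{c_n}(z_n)+e_n,\qquad y_{n+1}=\lambda_nu+\gamma_ny_n+\delta_nJ_{c_n}(y_n),\qquad y_0=z_0 .$$ (A function $g:\mathbb N\to\mathbb N$ is called monotone if $g(n)\le g(n+1)$ for all $n$, and $g^{(m)}$ is its $m$-th iterate.) Assume that there are $c\in\mathbb N\setminus\{0\}$ and monotone functions $h:\mathbb N\to\mathbb N\setminus\{0\}$ and $\ell,L,E:\mathbb N\to\mathbb N$ such that 1. $\lambda_n\ge \frac1{h(n)}$ for all $n\in\mathbb N$; 2. $\lambda_n\le\frac1{k+1}$ for all $k\in\mathbb N$ and $n\ge\ell(k)$; 3. $\sum_{i=1}^{L(k)}\lambda_i\ge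 k$ for all $k\in\mathbb N$; 4. $\min\{c_n,\delta_n^2\}\ge\frac1c$ for all $n\in\mathbb N$; 5. either $\sum_{i=E(k)+1}^{E(k)+n}\|e_i\|\le\frac1{k+1}$ for all $k,n\in\mathbb N$, or $\frac{\|e_n\|}{\lambda_n}\le\frac1{k+1}$ for all $k\in\mathbb N$ and $n\ge E(k)$. Let $D\in\mathbb N\setminus\{0\}$ satisfy $D\ge\max\{2\|u-p\|,\|z_0-p\|\}$ for some $p\in S$; let $\mathsf C:\mathbb N\to\mathbb N$ be monotone with $c_n\le\mathsf C(n)$ for all $n$; and let $d_0,d_1,d_2\in\mathbb N\setminus\{0\}$ satisfy $d_0\ge\max\{\|u-p'\|,\|z_0-p'\|\}$ for some $p'\in S$, $d_1\ge\sum_{i=0}^{E(0)}\|e_i\|+1$ and $d_2\ge\max\{\|z_i-y_i\|: i\le E(0)\}$. For $k,n\in\mathbb N$ and $f,g:\mathbb N\to\mathbb N$ define (those functions below that depend on $k$ and $f$ are built from the $k$ and $f$ at which $\mu$ is evaluated): - $\zeta(i,n)=c(i+1)\mathsf C(n)-1$, $\quad\overline\sigma(k,n)=L\big(n+\lceil\ln(12D^2(k+1))\rceil\big)+1$;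 - $\phi_2(i,n,g)=\max\{n,g^{(4D^2(i+1))}(n)\}$, $\quad\phi_1(i,n,g)=g(\phi_2(i,n,g))$, $\quad\widetilde f(n)=f(\overline\sigma(k,n))$; - $r_1(n)=12c(n+1)^2-1$, $\quad r_2(n)=\max\{2(n+1),128D(k+1)^2\}$; - $r_3(n)=\ell\big(\max\{96cD^2(n+1)^2-1,\;256D^2(k+1)^2-1,\;16c\,r_2(n)^2D^2\}\big)$; - $r_4(n)=3(k+1)\big(\widetilde f(\phi_2(r_1(n),r_3(n),\widetilde f+2))+1\big)$, $\quad\Phi(n)=\phi_1(r_1(n),r_3(n),\widetilde f+2)$; - $\Xi_1(n)=\zeta\big(2(6D+1)\max\{r_1(n),r_4(n)\}-1,\;\phi_1(r_1(n),r_3(n),\widetilde f+2)\big)$; - $\xi(n)=\zeta\big(\max\{16h(f(n))(k+1)^2(6D+1),\;4c\,r_2(n)^2(6D+1)\},\;f(n)\big)$; - $\Xi_2(n)=\xi(\Phi(n))$, $\quad\Xi(n)=\max\{\Xi_1(n),\Xi_2(n)\}$; - $w_g(m)=\max\{g(24D(m+1)^2),\,24D(m+1)^2\}$, $\quad\beta(i,g)=24D\big(w_g^{(R)}(0)+1\big)^2$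 with $R=4D^4(i+1)^2$; - $\mu(k,f)=\max\big\{\overline\sigma\big(k,\phi_2(r_1(b),r_3(b),\widetilde f+2)\big),\;\Phi(b)\big\}$ with $b=\beta(32(k+1)^2-1,\Xi)$; - $\Theta(k)=L\big(E(3k+2)+\lceil\ln(3d(k+1))\rceil\big)+1$ with $d=\max\{2d_0+d_1,d_2\}$. Then for all $k\in\mathbb N$ and every monotone $f:\mathbb N\to\mathbb N$, $$\exists n\le\nu(k,f)\;\forall i,j\in[n,f(n)]\;\Big(\|z_i-z_j\|\le\frac1{k+1}\Big),$$ where $\nu(k,f)=\max\{\mu(36(k+1)^2-1,\widehat f),\,\Theta(3k+2)\}$ and $\widehat f(m)=f(\max\{m,\Theta(3k+2)\})$. -/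

import Mathlib

noncomputable section

namespace MPPA

/-! ### Maximal monotone operators and resolvents -/

section Operators

variable {H : Type*} [NormedAddCommGroup H] [InnerProductSpace ℝ H]

/-- The graph of a set-valued operator `A : H → 2^H`. -/
def graph (A : H → Set H) : Set (H × H) := {q | q.2 ∈ A q.1}

/-- `A` is monotone: `⟨x - x', y - y'⟩ ≥ 0` for all `(x, y)`, `(x', y')` in its graph. -/
def IsMonotoneOp (A : H → Set H) : Prop :=
  ∀ q ∈ graph A, ∀ q' ∈ graph A, 0 ≤ inner ℝ (q.1 - q'.1) (q.2 - q'.2)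

/-- `A` is maximal monotone: it is monotone and its graph is not properly contained in the graph
of another monotone operator. -/
def IsMaximalMonotoneOp (A : H → Set H) : Prop :=
  IsMonotoneOp A ∧ ∀ B : H → Set H, IsMonotoneOp B → ¬ graph A ⊂ graph B

/-- The set `S = A⁻¹(0)` of zeros of `A`. -/
def zeros (A : H → Set H) : Set H := {x | (0 : H) ∈ A x}

/-- The set-valued map `(I + σ A)⁻¹`: the points `w` with `x ∈ w + σ A(w)`. -/
def resolventSet (A : H → Set H) (σ : ℝ) (x : H) : Set H :=
  {w | ∃ v ∈ A w, x = w + σ • v}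

open Classical in
/-- The resolvent function `J_σ = (I + σ A)⁻¹`. For `A` maximal monotone on a Hilbert space and
`σ > 0` the set `resolventSet A σ x` has exactly one point, and `J A σ x` is that point (the value
`0` is used only where that set is empty). -/
def J (A : H → Set H) (σ : ℝ) (x : H) : H :=
  if h : (resolventSet A σ x).Nonempty then h.some else 0

/-- `(x_n)` satisfies `x_{n+1} = λ_n u + γ_n x_n + δ_n J_{c_n}(x_n) + e_n` for all `n`. -/
def IsIteration (A : H → Set H) (u : H) (lam gam del cs : ℕ → ℝ) (e x : ℕ → H) : Prop :=
  ∀ n, x (n + 1) = lam n • u + gam n • x n + del n • J A (cs n) (x n) + e n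

end Operators

/-! ### The functions that build the bound -/

def zeta (c : ℕ) (C : ℕ → ℕ) (k n : ℕ) : ℕ := c * (k + 1) * C n - 1

def sigmaBar (L : ℕ → ℕ) (D k n : ℕ) : ℕ :=
  L (n + ⌈Real.log (12 * (D : ℝ) ^ 2 * ((k : ℝ) + 1))⌉₊) + 1

def phi2 (D k n : ℕ) (f : ℕ → ℕ) : ℕ := max n (f^[4 * D ^ 2 * (k + 1)] n)

def phi1 (D k n : ℕ) (f : ℕ → ℕ) : ℕ := f (phi2 D k n f)

def fTilde (k : ℕ) (f L : ℕ → ℕ) (D n : ℕ) : ℕ := f (sigmaBar L D k n)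

/-- The function `n ↦ f̃(n) + 2`. -/
def fTildeTwo (k : ℕ) (f L : ℕ → ℕ) (D n : ℕ) : ℕ := fTilde k f L D n + 2

def r1 (c n : ℕ) : ℕ := 12 * c * (n + 1) ^ 2 - 1

def r2 (k D n : ℕ) : ℕ := max (2 * (n + 1)) (128 * D * (k + 1) ^ 2)

def r3 (k c : ℕ) (l : ℕ → ℕ) (D n : ℕ) : ℕ :=
  l (max (max (96 * c * D ^ 2 * (n + 1) ^ 2 - 1) (256 * D ^ 2 * (k + 1) ^ 2 - 1))
    (16 * c * (r2 k D n) ^ 2 * D ^ 2))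

def r4 (k c : ℕ) (f l : ℕ → ℕ) (D : ℕ) (L : ℕ → ℕ) (n : ℕ) : ℕ :=
  3 * (k + 1) *
    (fTilde k f L D (phi2 D (r1 c n) (r3 k c l D n) (fTildeTwo k f L D)) + 1)

def Phi (k c : ℕ) (f l L : ℕ → ℕ) (D n : ℕ) : ℕ :=
  phi1 D (r1 c n) (r3 k c l D n) (fTildeTwo k f L D)

def Xi1 (k : ℕ) (f : ℕ → ℕ) (c : ℕ) (C l L : ℕ → ℕ) (D n : ℕ) : ℕ :=
  zeta c C (2 * (6 * D + 1) * max (r1 c n) (r4 k c f l D L n) - 1)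
    (phi1 D (r1 c n) (r3 k c l D n) (fTildeTwo k f L D))

def xi (k : ℕ) (f : ℕ → ℕ) (c : ℕ) (C : ℕ → ℕ) (D : ℕ) (h : ℕ → ℕ) (n : ℕ) : ℕ :=
  zeta c C
    (max (16 * h (f n) * (k + 1) ^ 2 * (6 * D + 1)) (4 * c * (r2 k D n) ^ 2 * (6 * D + 1)))
    (f n)

def Xi2 (k : ℕ) (f : ℕ → ℕ) (c : ℕ) (C l L : ℕ → ℕ) (D : ℕ) (h : ℕ → ℕ) (n : ℕ) : ℕ :=
  xi k f c C D h (Phi k c f l L D n)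

def Xi (k : ℕ) (f : ℕ → ℕ) (c : ℕ) (C l L : ℕ → ℕ) (D : ℕ) (h : ℕ → ℕ) (n : ℕ) : ℕ :=
  max (Xi1 k f c C l L D n) (Xi2 k f c C l L D h n)

def w (D : ℕ) (f : ℕ → ℕ) (m : ℕ) : ℕ :=
  max (f (24 * D * (m + 1) ^ 2)) (24 * D * (m + 1) ^ 2)

def beta (D k : ℕ) (f : ℕ → ℕ) : ℕ :=
  24 * D * ((w D f)^[4 * D ^ 4 * (k + 1) ^ 2] 0 + 1) ^ 2

/-- `β(k̄, Ξ)` with `k̄ = 32 (k + 1)² - 1`. -/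
def betaXi (c : ℕ) (C l L h : ℕ → ℕ) (D k : ℕ) (f : ℕ → ℕ) : ℕ :=
  beta D (32 * (k + 1) ^ 2 - 1) (Xi k f c C l L D h)

def mu (c : ℕ) (C l L h : ℕ → ℕ) (D k : ℕ) (f : ℕ → ℕ) : ℕ :=
  max
    (sigmaBar L D k
      (phi2 D (r1 c (betaXi c C l L h D k f)) (r3 k c l D (betaXi c C l L h D k f))
        (fTildeTwo k f L D)))
    (Phi k c f l L D (betaXi c C l L h D k f))

/-- `Θ(k) = L(E(3k+2) + ⌈ln(3 d (k+1))⌉) + 1` with `d = max {2 d₀ + d₁, d₂}`. -/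
def Theta (L E : ℕ → ℕ) (d₀ d₁ d₂ k : ℕ) : ℕ :=
  L (E (3 * k + 2) +
    ⌈Real.log (3 * ((max (2 * d₀ + d₁) d₂ : ℕ) : ℝ) * ((k : ℝ) + 1))⌉₊) + 1

/-- The function `f̂(m) = f(max {m, Θ(3k+2)})`. -/
def fHat (L E : ℕ → ℕ) (d₀ d₁ d₂ k : ℕ) (f : ℕ → ℕ) (m : ℕ) : ℕ :=
  f (max m (Theta L E d₀ d₁ d₂ (3 * k + 2)))

def nu (c : ℕ) (C l L h E : ℕ → ℕ) (D d₀ d₁ d₂ k : ℕ) (f : ℕ → ℕ) : ℕ :=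
  max (mu c C l L h D (36 * (k + 1) ^ 2 - 1) (fHat L E d₀ d₁ d₂ k f))
    (Theta L E d₀ d₁ d₂ (3 * k + 2))

end MPPA

end

/-!
Metastability of the multi-parameter proximal point algorithm with errors.

The exact iteration `y` is of Halpern type: if `x` is the projection of `u` onto the zero set of
`A`, then `‖y (n+1) - x‖² ≤ (1 - λ_n) ‖y n - x‖² + 2 λ_n ⟪u - x, y (n+1) - x⟫`. The inner product
is eventually almost nonpositive, because the `y n` become approximate zeros of `A`; and
`∑ λ_n = ∞` then forces `y n → x`. The quantitative version replaces `x` by a point that is only an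
approximate zero, to a precision `Ξ` that is fixed in advance as a function of the precision `η` at
which `x` satisfies the variational inequality `⟪u - x, y - x⟫ ≤ ε`
(`MPPA.exists_approx_projection`). No weak compactness is needed: `x` almost minimises the distance
to `u` on a set of approximate fixed points, at a level at which that distance has stopped
increasing.

With such an `x`, two cases are distinguished (`MPPA.exists_mu_norm_sub_sq_le`). If `‖y n - x‖`
decreases on a long interval, it is almost constant on a subinterval; firm nonexpansiveness then
makes the `y n` approximate zeros there, and the contraction inequality
(`MPPA.le_exp_neg_sum_mul_add`, `MPPA.exp_neg_sum_le`) can be iterated. Otherwise `‖y i - x‖` is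
bounded by its value just after the last increase before `i`, where the contraction inequality
alone gives a small value.

The distance between the inexact and the exact iteration obeys the same kind of recursion and tends
to `0` with rate `Theta` (`MPPA.le_of_Theta_le`).

The resolvents are everywhere defined by Minty's theorem (`MPPA.resolventSet_nonempty`). Its proof
minimises `‖a - b‖² / 4 + t` over the convex hull of the points `(a, b, ⟪a, b⟫)` with `(a, b)` in
the graph; strong convexity makes `a - b` converge along a minimising sequence, and half the limit
is the point sought.
-/

namespace MPPA

/-! ### Minty's theorem and resolvents -/

section Resolvents

variable {H : Type*} [NormedAddCommGroup H] [InnerProductSpace ℝ H]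

/-- On the convex hull of the points `(a, b, ⟪a, b⟫)` with `(a, b)` in a monotone set, the last
coordinate still dominates the inner product of the first two. -/
lemma inner_le_of_mem_convexHull {M : Set (H × H)}
    (hM : ∀ q ∈ M, ∀ q' ∈ M, 0 ≤ inner ℝ (q.1 - q'.1) (q.2 - q'.2))
    {z : H × H × ℝ}
    (hz : z ∈ convexHull ℝ ((fun q : H × H => (q.1, q.2, inner ℝ q.1 q.2)) '' M)) :
    inner ℝ z.1 z.2.1 ≤ z.2.2 := by
  set K : Set (H × H × ℝ) := (fun q : H × H => (q.1, q.2, inner ℝ q.1 q.2)) '' M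
  -- polarised form of the claim: it is affine in each of the two points separately
  have half : ∀ x : H × H × ℝ,
      Convex ℝ {y : H × H × ℝ | inner ℝ x.1 y.2.1 + inner ℝ y.1 x.2.1 ≤ x.2.2 + y.2.2} := by
    intro x y hy y' hy' s t hs ht hst
    simp only [Set.mem_ofPred_eq, Prod.fst_add, Prod.snd_add, Prod.smul_fst, Prod.smul_snd,
      inner_add_left, inner_add_right, real_inner_smul_left, real_inner_smul_right,
      smul_eq_mul] at hy hy' ⊢
    have e : x.2.2 = s * x.2.2 + t * x.2.2 := by rw [← add_mul, hst, one_mul]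
    rw [e]
    nlinarith [mul_le_mul_of_nonneg_left hy hs, mul_le_mul_of_nonneg_left hy' ht]
  have h1 : ∀ x ∈ K, ∀ y ∈ convexHull ℝ K,
      inner ℝ x.1 y.2.1 + inner ℝ y.1 x.2.1 ≤ x.2.2 + y.2.2 := by
    intro x hx
    refine fun y hy => convexHull_min (t := {y : H × H × ℝ |
      inner ℝ x.1 y.2.1 + inner ℝ y.1 x.2.1 ≤ x.2.2 + y.2.2}) ?_ (half x) hy
    rintro _ ⟨q', hq', rfl⟩
    obtain ⟨q, hq, rfl⟩ := hx
    have := hM q hq q' hq'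
    simp only [inner_sub_left, inner_sub_right] at this
    simp only [Set.mem_ofPred_eq]
    linarith
  have h2 := convexHull_min (t := {y : H × H × ℝ |
      inner ℝ z.1 y.2.1 + inner ℝ y.1 z.2.1 ≤ z.2.2 + y.2.2}) (fun x hx => by
        have := h1 x hx z hz
        simp only [Set.mem_ofPred_eq]
        linarith) (half z) hz
  simp only [Set.mem_ofPred_eq] at h2
  linarith

/-- The analytic core of Minty's theorem: `(w, -w)` is monotonically related to every point of a
monotone set, for some `w`. The point `w` is half the limit of `a - b` along a sequence that
minimises `‖a - b‖² / 4 + t` over the convex hull of the points `(a, b, ⟪a, b⟫)`. -/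
theorem exists_forall_inner_nonneg_of_monotone [CompleteSpace H] {M : Set (H × H)}
    (hM : ∀ q ∈ M, ∀ q' ∈ M, 0 ≤ inner ℝ (q.1 - q'.1) (q.2 - q'.2)) :
    ∃ w : H, ∀ q ∈ M, 0 ≤ inner ℝ (w - q.1) (-w - q.2) := by
  rcases M.eq_empty_or_nonempty with rfl | hne
  · exact ⟨0, by simp⟩
  set K : Set (H × H × ℝ) :=
    convexHull ℝ ((fun q : H × H => (q.1, q.2, inner ℝ q.1 q.2)) '' M) with hK
  have hKne : K.Nonempty := (hne.image _).convexHull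
  have hKc : Convex ℝ K := convex_convexHull ℝ _
  set F : H × H × ℝ → ℝ := fun z => ‖z.1 - z.2.1‖ ^ 2 / 4 + z.2.2 with hF
  have hF0 : ∀ z ∈ K, 0 ≤ F z := by
    intro z hz
    have h1 : inner ℝ z.1 z.2.1 ≤ z.2.2 := inner_le_of_mem_convexHull hM hz
    have h2 := norm_sub_sq_real z.1 z.2.1
    have h3 := norm_add_sq_real z.1 z.2.1
    simp only [hF]
    nlinarith [sq_nonneg ‖z.1 + z.2.1‖]
  have hbdd : BddBelow (F '' K) := ⟨0, by rintro _ ⟨z, hz, rfl⟩; exact hF0 z hz⟩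
  set m := sInf (F '' K) with hm
  have hmle : ∀ z ∈ K, m ≤ F z := fun z hz => csInf_le hbdd ⟨z, hz, rfl⟩
  have hm0 : 0 ≤ m := le_csInf (hKne.image _) (by rintro _ ⟨z, hz, rfl⟩; exact hF0 z hz)
  have hex : ∀ n : ℕ, ∃ z ∈ K, F z < m + 1 / ((n : ℝ) + 1) := by
    intro n
    obtain ⟨_, ⟨z, hz, rfl⟩, h⟩ := exists_lt_of_csInf_lt (hKne.image F)
      (show sInf (F '' K) < m + 1 / ((n : ℝ) + 1) by
        have : (0 : ℝ) < 1 / ((n : ℝ) + 1) := by positivity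
        linarith)
    exact ⟨z, hz, h⟩
  choose Z hZK hZ using hex
  set v : ℕ → H := fun n => (Z n).1 - (Z n).2.1 with hv
  have hcomb : ∀ z z' : H × H × ℝ, ∀ s t : ℝ,
      F (s • z + t • z') = ‖s • (z.1 - z.2.1) + t • (z'.1 - z'.2.1)‖ ^ 2 / 4
        + (s * z.2.2 + t * z'.2.2) := by
    intro z z' s t
    simp only [hF, Prod.fst_add, Prod.snd_add, Prod.smul_fst, Prod.smul_snd, smul_eq_mul]
    congr 4
    module
  -- strong convexity: almost minimisers are close to each other
  have hclose : ∀ i j, ‖v i - v j‖ ^ 2 ≤ 8 * (1 / ((i : ℝ) + 1) + 1 / ((j : ℝ) + 1)) := by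
    intro i j
    have h1 := hmle _ (hKc (hZK i) (hZK j) (by norm_num : (0 : ℝ) ≤ 1 / 2)
      (by norm_num : (0 : ℝ) ≤ 1 / 2) (by norm_num))
    rw [hcomb, ← smul_add, norm_smul] at h1
    have h2 := parallelogram_law_with_norm ℝ (v i) (v j)
    have h3 := hZ i
    have h4 := hZ j
    simp only [hF] at h3 h4
    simp only [hv] at h2 ⊢
    norm_num at h1
    nlinarith
  have hcau : CauchySeq v := by
    rw [Metric.cauchySeq_iff]
    intro ε hε
    obtain ⟨N, hN⟩ := exists_nat_one_div_lt (show (0 : ℝ) < ε ^ 2 / 16 by positivity)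
    refine ⟨N, fun i hi j hj => ?_⟩
    have mono : ∀ i : ℕ, N ≤ i → 1 / ((i : ℝ) + 1) ≤ 1 / ((N : ℝ) + 1) := fun i hi => by
      gcongr
    rw [dist_eq_norm]
    refine lt_of_pow_lt_pow_left₀ 2 hε.le ?_
    have := hclose i j
    have := mono i hi
    have := mono j hj
    linarith
  obtain ⟨V, hV⟩ := cauchySeq_tendsto_of_complete hcau
  have hεlim : Filter.Tendsto (fun n : ℕ => 1 / ((n : ℝ) + 1)) Filter.atTop (nhds 0) :=
    tendsto_one_div_add_atTop_nhds_zero_nat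
  have hFlim : Filter.Tendsto (fun n => F (Z n)) Filter.atTop (nhds m) := by
    refine tendsto_of_tendsto_of_tendsto_of_le_of_le tendsto_const_nhds
      (by simpa using hεlim.const_add m) (fun n => hmle _ (hZK n)) (fun n => (hZ n).le)
  set t : ℕ → ℝ := fun n => (Z n).2.2 with ht
  have htlim : Filter.Tendsto t Filter.atTop (nhds (m - ‖V‖ ^ 2 / 4)) := by
    have h := hFlim.sub ((hV.norm.pow 2).div_const 4)
    refine h.congr (fun n => ?_)
    simp [hF, hv, ht]
  refine ⟨(1 / 2 : ℝ) • V, fun q hq => ?_⟩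
  have hqK : (q.1, q.2, inner ℝ q.1 q.2) ∈ K := subset_convexHull ℝ _ ⟨q, hq, rfl⟩
  set x := q.1 - q.2 with hx
  set T := m - ‖V‖ ^ 2 / 4 with hT
  -- first-order optimality of the limit, before division by the step `θ`
  have hopt : ∀ θ : ℝ, 0 < θ → θ < 1 →
      m ≤ ‖(1 - θ) • V + θ • x‖ ^ 2 / 4 + ((1 - θ) * T + θ * inner ℝ q.1 q.2) := by
    intro θ h0 h1
    have hl : Filter.Tendsto (fun n => ‖(1 - θ) • v n + θ • x‖ ^ 2 / 4
        + ((1 - θ) * t n + θ * inner ℝ q.1 q.2)) Filter.atTop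
        (nhds (‖(1 - θ) • V + θ • x‖ ^ 2 / 4 + ((1 - θ) * T + θ * inner ℝ q.1 q.2))) :=
      ((((hV.const_smul _).add_const _).norm.pow 2).div_const 4).add
        ((htlim.const_mul _).add_const _)
    refine ge_of_tendsto' hl (fun n => ?_)
    have := hmle _ (hKc (hZK n) hqK (sub_nonneg.2 h1.le) h0.le (by ring))
    rwa [hcomb] at this
  have hlin : 0 ≤ inner ℝ V x / 2 - ‖V‖ ^ 2 / 2 - T + inner ℝ q.1 q.2 := by
    have key : ∀ θ : ℝ, 0 < θ → θ < 1 →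
        0 ≤ inner ℝ V x / 2 - ‖V‖ ^ 2 / 2 - T + inner ℝ q.1 q.2
          + θ * (‖x - V‖ ^ 2 / 4) := by
      intro θ h0 h1
      have h := hopt θ h0 h1
      have e : ‖(1 - θ) • V + θ • x‖ ^ 2
          = ‖V‖ ^ 2 + 2 * θ * (inner ℝ V x - ‖V‖ ^ 2) + θ ^ 2 * ‖x - V‖ ^ 2 := by
        have : (1 - θ) • V + θ • x = V + θ • (x - V) := by module
        rw [this, norm_add_sq_real, norm_smul, real_inner_smul_right, inner_sub_right,
          real_inner_self_eq_norm_sq, mul_pow, Real.norm_eq_abs, sq_abs]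
        ring
      rw [e] at h
      have h2 : 0 ≤ θ * (inner ℝ V x / 2 - ‖V‖ ^ 2 / 2 - T + inner ℝ q.1 q.2
          + θ * (‖x - V‖ ^ 2 / 4)) := by
        rw [hT] at h ⊢
        nlinarith
      exact nonneg_of_mul_nonneg_right h2 h0
    have hl : Filter.Tendsto (fun n : ℕ => inner ℝ V x / 2 - ‖V‖ ^ 2 / 2 - T + inner ℝ q.1 q.2
          + 1 / ((n : ℝ) + 1) * (‖x - V‖ ^ 2 / 4)) Filter.atTop
        (nhds (inner ℝ V x / 2 - ‖V‖ ^ 2 / 2 - T + inner ℝ q.1 q.2)) := by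
      simpa using (hεlim.mul_const (‖x - V‖ ^ 2 / 4)).const_add
        (inner ℝ V x / 2 - ‖V‖ ^ 2 / 2 - T + inner ℝ q.1 q.2)
    refine ge_of_tendsto hl ?_
    filter_upwards [Filter.eventually_gt_atTop 0] with n hn
    refine key _ (by positivity) ?_
    rw [div_lt_one (by positivity)]
    have : (0 : ℝ) < n := by exact_mod_cast hn
    linarith
  simp only [hx, hT, inner_sub_left, inner_sub_right, inner_neg_right,
    real_inner_smul_left, real_inner_smul_right, real_inner_self_eq_norm_sq] at hlin ⊢
  rw [real_inner_comm V q.1, norm_smul, mul_pow]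
  norm_num
  linarith

/-- **Minty's theorem**: the resolvents of a maximal monotone operator on a Hilbert space are
defined everywhere. -/
theorem resolventSet_nonempty [CompleteSpace H] {A : H → Set H} (hA : IsMaximalMonotoneOp A)
    {σ : ℝ} (hσ : 0 < σ) (x : H) : (resolventSet A σ x).Nonempty := by
  obtain ⟨w, hw⟩ := exists_forall_inner_nonneg_of_monotone
    (M := (fun q : H × H => (q.1, σ • q.2 - x)) '' graph A) (by
      rintro _ ⟨q, hq, rfl⟩ _ ⟨q', hq', rfl⟩
      have := mul_nonneg hσ.le (hA.1 q hq q' hq')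
      simpa [← smul_sub, real_inner_smul_right] using this)
  have hrel : ∀ q ∈ graph A, 0 ≤ inner ℝ (w - q.1) (σ⁻¹ • (x - w) - q.2) := by
    intro q hq
    have h1 := mul_nonneg (inv_nonneg.2 hσ.le) (hw _ ⟨q, hq, rfl⟩)
    rw [← real_inner_smul_right] at h1
    have e : σ⁻¹ • (-w - (σ • q.2 - x)) = σ⁻¹ • (x - w) - q.2 := by
      rw [show -w - (σ • q.2 - x) = (x - w) - σ • q.2 by abel, smul_sub,
        inv_smul_smul₀ hσ.ne']
    rwa [e] at h1
  -- adding `(w, σ⁻¹ (x - w))` to the graph keeps it monotone, so by maximality it is already there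
  set B : H → Set H := fun a => {b | b ∈ A a ∨ (a = w ∧ b = σ⁻¹ • (x - w))} with hB
  have hBm : IsMonotoneOp B := by
    rintro ⟨a, b⟩ hq ⟨a', b'⟩ hq'
    rcases hq with hq | ⟨ha, hb⟩ <;> rcases hq' with hq' | ⟨ha', hb'⟩ <;> dsimp only at *
    · exact hA.1 (a, b) hq (a', b') hq'
    · have := hrel (a, b) hq
      rw [← neg_sub a, ← neg_sub b, inner_neg_neg] at this
      rwa [ha', hb']
    · rw [ha, hb]
      exact hrel (a', b') hq'
    · simp [ha, ha']
  have hmem : (w, σ⁻¹ • (x - w)) ∈ graph A := by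
    by_contra hn
    refine hA.2 B hBm ⟨fun q hq => Or.inl hq, fun hsub => hn (hsub (Or.inr ⟨rfl, rfl⟩))⟩
  exact ⟨w, _, hmem, by rw [smul_inv_smul₀ hσ.ne']; abel⟩

variable [CompleteSpace H] {A : H → Set H}

lemma J_mem (hA : IsMaximalMonotoneOp A) {σ : ℝ} (hσ : 0 < σ) (x : H) :
    ∃ v ∈ A (J A σ x), x - J A σ x = σ • v := by
  have hne := resolventSet_nonempty hA hσ x
  obtain ⟨v, hv, h⟩ : J A σ x ∈ resolventSet A σ x := by
    rw [J, dif_pos hne]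
    exact hne.some_mem
  exact ⟨v, hv, sub_eq_of_eq_add' h⟩

lemma J_firm (hA : IsMaximalMonotoneOp A) {σ : ℝ} (hσ : 0 < σ) (x y : H) :
    0 ≤ inner ℝ (J A σ x - J A σ y) ((x - J A σ x) - (y - J A σ y)) := by
  obtain ⟨v, hv, h⟩ := J_mem hA hσ x
  obtain ⟨v', hv', h'⟩ := J_mem hA hσ y
  rw [h, h', ← smul_sub, real_inner_smul_right]
  exact mul_nonneg hσ.le (hA.1 (J A σ x, v) hv (J A σ y, v') hv')

lemma J_eq_self (hA : IsMaximalMonotoneOp A) {σ : ℝ} (hσ : 0 < σ) {p : H} (hp : p ∈ zeros A) :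
    J A σ p = p := by
  obtain ⟨v, hv, h⟩ := J_mem hA hσ p
  have h1 := mul_nonneg hσ.le (hA.1 (J A σ p, v) hv (p, 0) hp)
  rw [← real_inner_smul_right, sub_zero, ← h, ← neg_sub, inner_neg_left,
    real_inner_self_eq_norm_sq] at h1
  have : ‖p - J A σ p‖ ^ 2 = 0 := le_antisymm (by linarith) (sq_nonneg _)
  rw [sq_eq_zero_iff, norm_eq_zero, sub_eq_zero] at this
  exact this.symm

/-- Firm nonexpansiveness in its metric form. -/
lemma norm_J_sub_sq_add_le (hA : IsMaximalMonotoneOp A) {σ : ℝ} (hσ : 0 < σ) (x y : H) :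
    ‖J A σ x - J A σ y‖ ^ 2 + ‖(x - J A σ x) - (y - J A σ y)‖ ^ 2 ≤ ‖x - y‖ ^ 2 := by
  have h := J_firm hA hσ x y
  have e : x - y = (J A σ x - J A σ y) + ((x - J A σ x) - (y - J A σ y)) := by abel
  rw [e, norm_add_sq_real]
  linarith

lemma norm_J_sub_le (hA : IsMaximalMonotoneOp A) {σ : ℝ} (hσ : 0 < σ) (x y : H) :
    ‖J A σ x - J A σ y‖ ≤ ‖x - y‖ := by
  refine le_of_sq_le_sq ?_ (norm_nonneg _)
  have := norm_J_sub_sq_add_le hA hσ x y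
  nlinarith [sq_nonneg ‖(x - J A σ x) - (y - J A σ y)‖]

lemma norm_J_sub_zero_le (hA : IsMaximalMonotoneOp A) {σ : ℝ} (hσ : 0 < σ) {p : H}
    (hp : p ∈ zeros A) (x : H) : ‖J A σ x - p‖ ≤ ‖x - p‖ := by
  simpa [J_eq_self hA hσ hp] using norm_J_sub_le hA hσ x p

lemma norm_sub_J_le (hA : IsMaximalMonotoneOp A) {σ : ℝ} (hσ : 0 < σ) {p : H}
    (hp : p ∈ zeros A) (x : H) : ‖x - J A σ x‖ ≤ ‖x - p‖ := by
  refine le_of_sq_le_sq ?_ (norm_nonneg _)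
  have := norm_J_sub_sq_add_le hA hσ x p
  rw [J_eq_self hA hσ hp, sub_self, sub_zero] at this
  nlinarith [sq_nonneg ‖J A σ x - p‖]

/-- For `t ≤ s` the displacement `‖x - J_σ x‖` grows from `σ = t` to `σ = s`, but not faster than
linearly. -/
lemma norm_sub_J_compare (hA : IsMaximalMonotoneOp A) {t s : ℝ} (ht : 0 < t) (hts : t ≤ s)
    (x : H) :
    ‖x - J A t x‖ ≤ ‖x - J A s x‖ ∧ ‖x - J A s x‖ ≤ s / t * ‖x - J A t x‖ := by
  have hs : 0 < s := ht.trans_le hts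
  obtain ⟨v, hv, h⟩ := J_mem hA hs x
  obtain ⟨v', hv', h'⟩ := J_mem hA ht x
  have h1 := hA.1 (J A s x, v) hv (J A t x, v') hv'
  have e : J A s x - J A t x = t • v' - s • v := by rw [← h, ← h']; abel
  simp only [e] at h1
  rw [h, h', norm_smul, norm_smul, Real.norm_of_nonneg hs.le, Real.norm_of_nonneg ht.le]
  simp only [inner_sub_left, inner_sub_right, real_inner_smul_left,
    real_inner_self_eq_norm_sq, real_inner_comm v v'] at h1
  have hcs := real_inner_le_norm v v'
  have hcs' : inner ℝ v v' * (s + t) ≤ ‖v‖ * ‖v'‖ * (s + t) := by gcongr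
  have hprod : (‖v‖ - ‖v'‖) * (s * ‖v‖ - t * ‖v'‖) ≤ 0 := by
    have hc := real_inner_comm v v'
    nlinarith
  have hv0 := norm_nonneg v
  have hv0' := norm_nonneg v'
  have hle : ‖v‖ ≤ ‖v'‖ := by
    by_contra hlt
    push Not at hlt
    have : t * ‖v'‖ < s * ‖v‖ := by nlinarith
    nlinarith
  refine ⟨?_, ?_⟩
  · by_contra hlt
    push Not at hlt
    have hlt' : ‖v‖ < ‖v'‖ := by
      refine lt_of_le_of_ne hle (fun heq => ?_)
      rw [heq] at hlt
      nlinarith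
    nlinarith
  · rw [← mul_assoc, div_mul_cancel₀ _ ht.ne']
    gcongr

end Resolvents

/-! ### A quantitative projection argument -/

section Projection

/-- A pigeonhole principle: of `R` steps with total increase at most `B`, one increases by at most
`B / R`. -/
lemma exists_step_le (b : ℕ → ℝ) {R : ℕ} (hR : 0 < R) {B : ℝ} (hB : b R - b 0 ≤ B) :
    ∃ i < R, b (i + 1) - b i ≤ B / R := by
  by_contra! hcon
  have hR' : (0 : ℝ) < R := by exact_mod_cast hR
  have h := Finset.sum_lt_sum_of_nonempty (s := Finset.range R) (f := fun _ => B / R)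
    (g := fun i => b (i + 1) - b i) (Finset.nonempty_range_iff.2 hR.ne')
    (fun i hi => hcon i (Finset.mem_range.1 hi))
  rw [Finset.sum_range_sub, Finset.sum_const, Finset.card_range, nsmul_eq_mul,
    mul_div_cancel₀ _ hR'.ne'] at h
  linarith

variable {H : Type*} [NormedAddCommGroup H] [InnerProductSpace ℝ H]

/-- Points on a segment between two approximate fixed points of a nonexpansive map are approximate
fixed points. -/
lemma norm_sub_map_segment_sq_le {T : H → H} (hT : ∀ x y, ‖T x - T y‖ ≤ ‖x - y‖) {x y : H}
    {ε d t : ℝ} (hx : ‖x - T x‖ ≤ ε) (hy : ‖y - T y‖ ≤ ε) (hd : ‖x - y‖ ≤ d)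
    (h0 : 0 ≤ t) (h1 : t ≤ 1) :
    ‖(x + t • (y - x)) - T (x + t • (y - x))‖ ^ 2 ≤ d * ε + ε ^ 2 := by
  set z := x + t • (y - x) with hz
  have hε : 0 ≤ ε := (norm_nonneg _).trans hx
  have hzx : ‖z - x‖ = t * ‖x - y‖ := by
    rw [hz, add_sub_cancel_left, norm_smul, Real.norm_of_nonneg h0, norm_sub_rev]
  have hzy : ‖z - y‖ = (1 - t) * ‖x - y‖ := by
    rw [show z - y = (1 - t) • (x - y) by rw [hz]; module, norm_smul,
      Real.norm_of_nonneg (sub_nonneg.2 h1)]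
  have ha : ‖T z - x‖ ≤ t * ‖x - y‖ + ε := by
    calc ‖T z - x‖ = ‖(T z - T x) - (x - T x)‖ := by congr 1; abel
      _ ≤ ‖T z - T x‖ + ‖x - T x‖ := norm_sub_le _ _
      _ ≤ t * ‖x - y‖ + ε := add_le_add ((hT z x).trans hzx.le) hx
  have hb : ‖T z - y‖ ≤ (1 - t) * ‖x - y‖ + ε := by
    calc ‖T z - y‖ = ‖(T z - T y) - (y - T y)‖ := by congr 1; abel
      _ ≤ ‖T z - T y‖ + ‖y - T y‖ := norm_sub_le _ _
      _ ≤ (1 - t) * ‖x - y‖ + ε := add_le_add ((hT z y).trans hzy.le) hy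
  have key : ‖z - T z‖ ^ 2
      = (1 - t) * ‖T z - x‖ ^ 2 + t * ‖T z - y‖ ^ 2 - t * (1 - t) * ‖x - y‖ ^ 2 := by
    have e1 : z - T z = -((1 - t) • (T z - x) + t • (T z - y)) := by
      rw [hz]; module
    have e2 : x - y = (T z - y) - (T z - x) := by abel
    rw [e1, norm_neg, e2, norm_add_sq_real, norm_sub_sq_real (T z - y), norm_smul, norm_smul,
      Real.norm_of_nonneg h0, Real.norm_of_nonneg (sub_nonneg.2 h1), real_inner_smul_left,
      real_inner_smul_right, real_inner_comm (T z - x)]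
    ring
  have ha2 : ‖T z - x‖ ^ 2 ≤ (t * ‖x - y‖ + ε) ^ 2 := by gcongr
  have hb2 : ‖T z - y‖ ^ 2 ≤ ((1 - t) * ‖x - y‖ + ε) ^ 2 := by gcongr
  have hdε : ‖x - y‖ * ε ≤ d * ε := by gcongr
  have h4 : 4 * t * (1 - t) * (‖x - y‖ * ε) ≤ ‖x - y‖ * ε := by
    have : 0 ≤ ‖x - y‖ * ε := by positivity
    nlinarith [sq_nonneg (2 * t - 1)]
  have ha3 := mul_le_mul_of_nonneg_left ha2 (sub_nonneg.2 h1)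
  have hb3 := mul_le_mul_of_nonneg_left hb2 h0
  rw [key]
  nlinarith

/-- An approximate point that plays the role of the metric projection of `u` onto the fixed point
set of `T`. Along the iterates `m_i = w^[i] 0` the squared distance from `u` to the set of
`1 / (m_i + 1)`-approximate fixed points is increasing and bounded by `D² / 4`, so between some
`m_i` and `m_{i+1}` it hardly increases; an almost closest point at level `m_{i+1}` then satisfies
the variational inequality against all points that are approximately fixed to the precision
`24 D (m_i + 1)²`. -/
theorem exists_approx_projection {T : H → H} (hT : ∀ x y, ‖T x - T y‖ ≤ ‖x - y‖) {p u : H}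
    (hp : T p = p) {D : ℕ} (hD0 : 0 < D) (hu : 2 * ‖u - p‖ ≤ D) (k : ℕ) (g : ℕ → ℕ) :
    ∃ η ≤ beta D k g, ∃ x, ‖x - p‖ ≤ D ∧ ‖x - T x‖ ≤ 1 / ((g η : ℝ) + 1) ∧
      ∀ y, ‖y - p‖ ≤ D → ‖y - T y‖ ≤ 1 / ((η : ℝ) + 1) →
        inner ℝ (u - x) (y - x) ≤ 1 / ((k : ℝ) + 1) := by
  have hD : (1 : ℝ) ≤ D := by exact_mod_cast hD0
  set S : ℕ → Set H := fun m => {y | ‖y - p‖ ≤ D ∧ ‖y - T y‖ ≤ 1 / ((m : ℝ) + 1)} with hS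
  set a : ℕ → ℝ := fun m => sInf ((fun y => ‖u - y‖ ^ 2) '' S m) with ha
  have hpS : ∀ m, p ∈ S m := fun m => by
    refine ⟨by simp, ?_⟩
    rw [hp, sub_self, norm_zero]
    positivity
  have hbdd : ∀ m, BddBelow ((fun y => ‖u - y‖ ^ 2) '' S m) := fun m =>
    ⟨0, by rintro _ ⟨y, -, rfl⟩; positivity⟩
  have hale : ∀ m, ∀ y ∈ S m, a m ≤ ‖u - y‖ ^ 2 := fun m y hy =>
    csInf_le (hbdd m) ⟨y, hy, rfl⟩
  have ha0 : ∀ m, 0 ≤ a m := fun m =>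
    le_csInf ⟨_, p, hpS m, rfl⟩ (by rintro _ ⟨y, -, rfl⟩; positivity)
  have haD : ∀ m, a m ≤ (D : ℝ) ^ 2 / 4 := fun m => by
    have := hale m p (hpS m)
    nlinarith [norm_nonneg (u - p)]
  set R := 4 * D ^ 4 * (k + 1) ^ 2 with hR
  set M : ℕ → ℕ := fun i => (w D g)^[i] 0 with hM
  have hMsucc : ∀ i, M (i + 1) = w D g (M i) := fun i => Function.iterate_succ_apply' _ _ _
  have hwle : ∀ m, 24 * D * (m + 1) ^ 2 ≤ w D g m := fun m => le_max_right _ _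
  have hMmono : Monotone M := monotone_nat_of_le_succ fun i => by
    rw [hMsucc]
    refine le_trans ?_ (hwle _)
    nlinarith [Nat.mul_le_mul hD0 (Nat.le_refl ((M i + 1) ^ 2))]
  obtain ⟨i, hiR, hi⟩ := exists_step_le (fun i => a (M i)) (R := R) (by positivity)
    (B := (D : ℝ) ^ 2 / 4) (by have := haD (M R); have := ha0 (M 0); linarith)
  set κ : ℝ := 1 / (16 * (D : ℝ) ^ 2 * ((k : ℝ) + 1) ^ 2) with hκ
  have hκ0 : 0 < κ := by positivity
  have hstep : (D : ℝ) ^ 2 / 4 / (R : ℝ) = κ := by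
    rw [hR, hκ]
    push_cast
    field_simp
    norm_num
  rw [hstep] at hi
  obtain ⟨_, ⟨x, hxS, rfl⟩, hx⟩ := exists_lt_of_csInf_lt
    (⟨_, p, hpS (M (i + 1)), rfl⟩ : ((fun y => ‖u - y‖ ^ 2) '' S (M (i + 1))).Nonempty)
    (show a (M (i + 1)) < a (M (i + 1)) + κ by linarith)
  set η := 24 * D * (M i + 1) ^ 2 with hη
  have hηM : η ≤ M (i + 1) := by rw [hMsucc]; exact hwle _
  have hgM : g η ≤ M (i + 1) := by rw [hMsucc]; exact le_max_left _ _
  refine ⟨η, ?_, x, hxS.1, hxS.2.trans ?_, fun y hyD hyT => ?_⟩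
  · have : M i ≤ M R := hMmono hiR.le
    rw [hη, beta]
    gcongr
  · gcongr
  have hxT : ‖x - T x‖ ≤ 1 / ((η : ℝ) + 1) := hxS.2.trans (by gcongr)
  have hxy : ‖x - y‖ ≤ 2 * D := by
    calc ‖x - y‖ = ‖(x - p) - (y - p)‖ := by congr 1; abel
      _ ≤ ‖x - p‖ + ‖y - p‖ := norm_sub_le _ _
      _ ≤ 2 * D := by linarith [hxS.1]
  set t : ℝ := 1 / (4 * (D : ℝ) ^ 2 * ((k : ℝ) + 1)) with ht
  have hk : (0 : ℝ) ≤ k := Nat.cast_nonneg k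
  have ht0 : 0 < t := by positivity
  have ht1 : t ≤ 1 := by
    rw [ht, div_le_one (by positivity)]
    nlinarith
  set z := x + t • (y - x) with hz
  have hzS : z ∈ S (M i) := by
    refine ⟨?_, ?_⟩
    · have e : z - p = (1 - t) • (x - p) + t • (y - p) := by rw [hz]; module
      rw [e]
      refine (norm_add_le _ _).trans ?_
      rw [norm_smul, norm_smul, Real.norm_of_nonneg ht0.le,
        Real.norm_of_nonneg (sub_nonneg.2 ht1)]
      nlinarith [hxS.1, mul_le_mul_of_nonneg_left hxS.1 (sub_nonneg.2 ht1)]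
    · have h := norm_sub_map_segment_sq_le hT hxT hyT hxy ht0.le ht1
      refine le_of_sq_le_sq (h.trans ?_) (by positivity)
      set ε : ℝ := 1 / ((η : ℝ) + 1) with hε
      have hε0 : 0 < ε := by positivity
      have hε1 : ε ≤ 1 / (24 * D * ((M i : ℝ) + 1) ^ 2) := by
        rw [hε, hη]
        push_cast
        gcongr
        linarith
      have hεle : ε ≤ 1 := by
        rw [hε, div_le_one (by positivity)]
        have : (0 : ℝ) ≤ η := Nat.cast_nonneg η
        linarith
      calc 2 * (D : ℝ) * ε + ε ^ 2 ≤ 3 * D * ε := by nlinarith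
        _ ≤ 3 * D * (1 / (24 * D * ((M i : ℝ) + 1) ^ 2)) := by gcongr
        _ = 1 / 8 * (1 / ((M i : ℝ) + 1)) ^ 2 := by field_simp; norm_num
        _ ≤ (1 / ((M i : ℝ) + 1)) ^ 2 := by
          have : 0 ≤ (1 / ((M i : ℝ) + 1)) ^ 2 := by positivity
          linarith
  have h1 := hale (M i) z hzS
  have h2 : ‖u - z‖ ^ 2 = ‖u - x‖ ^ 2 - 2 * t * inner ℝ (u - x) (y - x)
      + t ^ 2 * ‖x - y‖ ^ 2 := by
    have e : u - z = (u - x) - t • (y - x) := by rw [hz]; abel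
    rw [e, norm_sub_sq_real, norm_smul, real_inner_smul_right, Real.norm_of_nonneg ht0.le,
      norm_sub_rev y x]
    ring
  have h3 : ‖x - y‖ ^ 2 ≤ (2 * D) ^ 2 := by gcongr
  have h4 : 2 * t * inner ℝ (u - x) (y - x) ≤ 2 * κ + t ^ 2 * (2 * D) ^ 2 := by
    have := mul_le_mul_of_nonneg_left h3 (sq_nonneg t)
    simp only at hx hi
    linarith
  have e1 : 2 * κ + t ^ 2 * (2 * (D : ℝ)) ^ 2 = 2 * t * (3 / 4 * (1 / ((k : ℝ) + 1))) := by
    rw [hκ, ht]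
    field_simp
    norm_num
  rw [e1] at h4
  have h5 := le_of_mul_le_mul_left h4 (by positivity)
  have : 0 ≤ 1 / ((k : ℝ) + 1) := by positivity
  linarith

end Projection

/-! ### Recursive inequalities -/

section Recursion

lemma le_exp_neg_sum_mul_add {s lam v : ℕ → ℝ} {b B : ℝ} {N n : ℕ} (hNn : N ≤ n)
    (h0 : ∀ j, 0 ≤ lam j) (h1 : ∀ j, lam j ≤ 1) (hv : ∀ j, 0 ≤ v j) (hB : 0 ≤ B) (hb : 0 ≤ b)
    (hN : s N ≤ B)
    (hs : ∀ j, N ≤ j → j < n → s (j + 1) ≤ (1 - lam j) * s j + lam j * b + v j) :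
    s n ≤ Real.exp (-∑ j ∈ Finset.Ico N n, lam j) * B + b + ∑ j ∈ Finset.Ico N n, v j := by
  induction n, hNn using Nat.le_induction with
  | base => simp; linarith
  | succ n hn ih =>
    have ih := ih fun j hj hjn => hs j hj (hjn.trans n.lt_succ_self)
    have hstep := hs n hn n.lt_succ_self
    rw [Finset.sum_Ico_succ_top hn, Finset.sum_Ico_succ_top hn, neg_add, Real.exp_add]
    set X := Real.exp (-∑ j ∈ Finset.Ico N n, lam j)
    set V := ∑ j ∈ Finset.Ico N n, v j
    have hX : 0 ≤ X * B := mul_nonneg (Real.exp_pos _).le hB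
    have hV : 0 ≤ V := Finset.sum_nonneg fun j _ => hv j
    have hexp : 1 - lam n ≤ Real.exp (-lam n) := by
      have := Real.add_one_le_exp (-lam n)
      linarith
    have hl := sub_nonneg.2 (h1 n)
    have e1 := mul_le_mul_of_nonneg_left ih hl
    have e2 := mul_le_mul_of_nonneg_right hexp hX
    have e3 := mul_nonneg (h0 n) hV
    nlinarith

variable {lam : ℕ → ℝ} {L : ℕ → ℕ}

/-- As `λ_i ≤ 1`, a rate of divergence of `∑ λ_i` is at least the identity. -/
lemma le_rate (h1 : ∀ j, lam j ≤ 1)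
    (hQ3 : ∀ k : ℕ, (k : ℝ) ≤ ∑ i ∈ Finset.Icc 1 (L k), lam i) (k : ℕ) : k ≤ L k := by
  have h := (hQ3 k).trans (Finset.sum_le_sum fun i _ => h1 i)
  simp at h
  exact h

/-- A rate of divergence of `∑ λ_i` turns into a rate at which `exp (-∑ λ_i)` tends to `0`; the sum
may skip the first `N` indices after `0` since `λ_i ≤ 1`. -/
lemma exp_neg_sum_le (h0 : ∀ j, 0 ≤ lam j) (h1 : ∀ j, lam j ≤ 1)
    (hQ3 : ∀ k : ℕ, (k : ℝ) ≤ ∑ i ∈ Finset.Icc 1 (L k), lam i) {N N' n : ℕ} (hN : N' ≤ N + 1)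
    {X : ℝ} (hX : 0 < X) (hn : L (N + ⌈Real.log X⌉₊) + 1 ≤ n) :
    Real.exp (-∑ j ∈ Finset.Ico N' n, lam j) ≤ 1 / X := by
  set K := N + ⌈Real.log X⌉₊ with hK
  have hsum : ∑ i ∈ Finset.Icc 1 (L K), lam i
      ≤ ∑ i ∈ Finset.Ico 1 N', lam i + ∑ i ∈ Finset.Ico N' n, lam i := by
    rw [← Finset.sum_union (Finset.disjoint_left.2 fun i hi hi' => by
      simp only [Finset.mem_Ico] at hi hi'; omega)]
    refine Finset.sum_le_sum_of_subset_of_nonneg (fun i hi => ?_) fun i _ _ => h0 i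
    simp only [Finset.mem_union, Finset.mem_Ico, Finset.mem_Icc] at hi ⊢
    omega
  have hfew : ∑ i ∈ Finset.Ico 1 N', lam i ≤ N := by
    refine (Finset.sum_le_sum fun i _ => h1 i).trans ?_
    simp only [Finset.sum_const, Nat.card_Ico, nsmul_eq_mul, mul_one]
    exact_mod_cast (by omega : N' - 1 ≤ N)
  have hlog : Real.log X ≤ ∑ i ∈ Finset.Ico N' n, lam i := by
    have h := hQ3 K
    rw [hK] at h
    push_cast at h
    have := Nat.le_ceil (Real.log X)
    linarith
  calc Real.exp (-∑ j ∈ Finset.Ico N' n, lam j) ≤ Real.exp (-Real.log X) := by gcongr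
    _ = 1 / X := by rw [Real.exp_neg, Real.exp_log hX, one_div]

end Recursion

/-! ### One step of the iteration -/

section Step

lemma norm_sub_le_add {H : Type*} [NormedAddCommGroup H] {x y p : H} {a b : ℝ}
    (hx : ‖x - p‖ ≤ a) (hy : ‖y - p‖ ≤ b) :
    ‖x - y‖ ≤ a + b := by
  calc ‖x - y‖ = ‖(x - p) - (y - p)‖ := by congr 1; abel
    _ ≤ ‖x - p‖ + ‖y - p‖ := norm_sub_le _ _
    _ ≤ a + b := add_le_add hx hy

lemma norm_smul_add_smul_sq_le {H : Type*} [NormedAddCommGroup H] [InnerProductSpace ℝ H]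
    (a b : H) {s t : ℝ} (hs : 0 ≤ s) (ht : 0 ≤ t) :
    ‖s • a + t • b‖ ^ 2 ≤ (s + t) * (s * ‖a‖ ^ 2 + t * ‖b‖ ^ 2) := by
  have h : ‖s • a + t • b‖ ^ 2
      = (s + t) * (s * ‖a‖ ^ 2 + t * ‖b‖ ^ 2) - s * t * ‖a - b‖ ^ 2 := by
    rw [norm_add_sq_real, norm_sub_sq_real, norm_smul, norm_smul, real_inner_smul_left,
      real_inner_smul_right, Real.norm_of_nonneg hs, Real.norm_of_nonneg ht]
    ring
  have := mul_nonneg (mul_nonneg hs ht) (sq_nonneg ‖a - b‖)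
  linarith

variable {H : Type*} [NormedAddCommGroup H] [InnerProductSpace ℝ H] [CompleteSpace H]
  {A : H → Set H}

lemma IsIteration.norm_sub_le (hA : IsMaximalMonotoneOp A) {lam gam del cs : ℕ → ℝ}
    (hcs : ∀ n, 0 < cs n) (hlam : ∀ n, 0 ≤ lam n) (hgam : ∀ n, 0 ≤ gam n)
    (hdel : ∀ n, 0 ≤ del n) (hsum : ∀ n, lam n + gam n + del n = 1) {u : H} {y : ℕ → H}
    (hy : IsIteration A u lam gam del cs 0 y) {p : H} (hp : p ∈ zeros A) {B : ℝ}
    (hu : ‖u - p‖ ≤ B) (h0 : ‖y 0 - p‖ ≤ B) (n : ℕ) : ‖y n - p‖ ≤ B := by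
  induction n with
  | zero => exact h0
  | succ n ih =>
    have e : y (n + 1) - p
        = lam n • (u - p) + gam n • (y n - p) + del n • (J A (cs n) (y n) - p) := by
      rw [hy n, Pi.zero_apply, add_zero]
      have : p = (lam n + gam n + del n) • p := by rw [hsum, one_smul]
      nth_rw 1 [this]
      module
    have hJ := (norm_J_sub_zero_le hA (hcs n) hp (y n)).trans ih
    rw [e]
    refine (norm_add₃_le).trans ?_
    rw [norm_smul, norm_smul, norm_smul, Real.norm_of_nonneg (hlam n),
      Real.norm_of_nonneg (hgam n), Real.norm_of_nonneg (hdel n)]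
    have h1 := mul_le_mul_of_nonneg_left hu (hlam n)
    have h2 := mul_le_mul_of_nonneg_left ih (hgam n)
    have h3 := mul_le_mul_of_nonneg_left hJ (hdel n)
    have h4 : lam n * B + gam n * B + del n * B = B := by rw [← add_mul, ← add_mul, hsum, one_mul]
    linarith

/-- Firm nonexpansiveness of the resolvent relative to an approximate fixed point `x`. -/
lemma norm_J_sub_approx_sq_le (hA : IsMaximalMonotoneOp A) {σ : ℝ} (hσ : 0 < σ) {p x y : H}
    (hp : p ∈ zeros A) {D ε : ℝ} (hx : ‖x - p‖ ≤ D) (hy : ‖y - p‖ ≤ D)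
    (hε : ‖x - J A σ x‖ ≤ ε) :
    ‖J A σ y - x‖ ^ 2 + ‖y - J A σ y‖ ^ 2 ≤ ‖y - x‖ ^ 2 + 6 * D * ε := by
  have hfirm := J_firm hA hσ y x
  set Jy := J A σ y
  set Jx := J A σ x
  have h1 : ‖Jy - Jx‖ ≤ 2 * D := by
    have := norm_sub_le_add ((norm_J_sub_zero_le hA hσ hp y).trans hy)
      ((norm_J_sub_zero_le hA hσ hp x).trans hx)
    linarith
  have h2 : ‖y - Jy‖ ≤ D := (norm_sub_J_le hA hσ hp y).trans hy
  have hε0 : 0 ≤ ε := (norm_nonneg _).trans hε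
  have h3 : inner ℝ (x - Jx) ((y - Jy) - (Jy - Jx)) ≤ 3 * D * ε := by
    have hn : ‖(y - Jy) - (Jy - Jx)‖ ≤ 3 * D := (_root_.norm_sub_le _ _).trans (by linarith)
    calc inner ℝ (x - Jx) ((y - Jy) - (Jy - Jx)) ≤ ‖x - Jx‖ * ‖(y - Jy) - (Jy - Jx)‖ :=
        real_inner_le_norm _ _
      _ ≤ ε * (3 * D) := by gcongr
      _ = 3 * D * ε := by ring
  have e : y - x = (Jy - x) + (y - Jy) := by abel
  have e2 : Jy - x = (Jy - Jx) - (x - Jx) := by abel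
  have h4 : inner ℝ (Jy - x) (y - Jy) = inner ℝ (Jy - Jx) ((y - Jy) - (x - Jx))
      - inner ℝ (x - Jx) ((y - Jy) - (Jy - Jx)) := by
    rw [e2, inner_sub_left, inner_sub_right (Jy - Jx) (y - Jy) (x - Jx),
      inner_sub_right (x - Jx) (y - Jy) (Jy - Jx), real_inner_comm (Jy - Jx) (x - Jx)]
    ring
  rw [e, norm_add_sq_real, h4]
  linarith

variable {σ lam gam del D ε : ℝ} {p u x y y' : H}

/-- The contraction inequality of Halpern type, relative to an approximate fixed point `x`. -/
lemma step_norm_sq_le (hA : IsMaximalMonotoneOp A) (hσ : 0 < σ) (hlam : 0 ≤ lam)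
    (hgam : 0 ≤ gam) (hdel : 0 ≤ del) (hsum : lam + gam + del = 1)
    (hy' : y' = lam • u + gam • y + del • J A σ y) (hp : p ∈ zeros A)
    (hx : ‖x - p‖ ≤ D) (hy : ‖y - p‖ ≤ D) (hε : ‖x - J A σ x‖ ≤ ε) :
    ‖y' - x‖ ^ 2 ≤ (1 - lam) * ‖y - x‖ ^ 2 + 2 * lam * inner ℝ (u - x) (y' - x)
      + 6 * D * ε := by
  have hD : 0 ≤ D := (norm_nonneg _).trans hx
  have hDε : 0 ≤ 6 * D * ε := mul_nonneg (by positivity) ((norm_nonneg _).trans hε)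
  have hJ := norm_J_sub_approx_sq_le hA hσ hp hx hy hε
  have hJ' : ‖J A σ y - x‖ ^ 2 ≤ ‖y - x‖ ^ 2 + 6 * D * ε := by
    have := sq_nonneg ‖y - J A σ y‖
    linarith
  have e : gam • (y - x) + del • (J A σ y - x) = (y' - x) - lam • (u - x) := by
    have : x = (lam + gam + del) • x := by rw [hsum, one_smul]
    rw [hy']
    nth_rw 3 [this]
    module
  have h1 := norm_smul_add_smul_sq_le (y - x) (J A σ y - x) hgam hdel
  have h2 : ‖y' - x‖ ^ 2 - 2 * lam * inner ℝ (u - x) (y' - x)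
      ≤ ‖(y' - x) - lam • (u - x)‖ ^ 2 := by
    rw [norm_sub_sq_real (y' - x), real_inner_smul_right, real_inner_comm (u - x)]
    have := sq_nonneg ‖lam • (u - x)‖
    linarith
  rw [e, show gam + del = 1 - lam by linarith] at h1
  have hl : 0 ≤ 1 - lam := by linarith
  have h3 : gam * ‖y - x‖ ^ 2 + del * ‖J A σ y - x‖ ^ 2
      ≤ (1 - lam) * ‖y - x‖ ^ 2 + 6 * D * ε := by
    have h4 := mul_le_mul_of_nonneg_left hJ' hdel
    have h5 : del * (6 * D * ε) ≤ 1 * (6 * D * ε) := by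
      gcongr
      linarith
    have h6 : gam = 1 - lam - del := by linarith
    rw [h6]
    linarith
  have h4 := mul_le_mul_of_nonneg_left h3 hl
  have h5 : (1 - lam) * ((1 - lam) * ‖y - x‖ ^ 2 + 6 * D * ε)
      ≤ 1 * ((1 - lam) * ‖y - x‖ ^ 2 + 6 * D * ε) := by
    have : 0 ≤ (1 - lam) * ‖y - x‖ ^ 2 + 6 * D * ε :=
      add_nonneg (mul_nonneg hl (sq_nonneg _)) hDε
    gcongr
    linarith
  linarith

/-- The displacement of `y` by the resolvent is controlled by the decrease of the distance to an
approximate fixed point `x`. -/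
lemma step_norm_sub_J_sq_le (hA : IsMaximalMonotoneOp A) (hσ : 0 < σ) (hlam : 0 ≤ lam)
    (hgam : 0 ≤ gam) (hdel : 0 ≤ del) (hsum : lam + gam + del = 1)
    (hy' : y' = lam • u + gam • y + del • J A σ y) (hp : p ∈ zeros A)
    (hu : ‖u - p‖ ≤ D) (hx : ‖x - p‖ ≤ D) (hy : ‖y - p‖ ≤ D) (hε : ‖x - J A σ x‖ ≤ ε) :
    del * ‖y - J A σ y‖ ^ 2
      ≤ ‖y - x‖ ^ 2 - ‖y' - x‖ ^ 2 + 4 * D ^ 2 * lam + 6 * D * ε := by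
  have hD : 0 ≤ D := (norm_nonneg _).trans hx
  have hDε : 0 ≤ 6 * D * ε := mul_nonneg (by positivity) ((norm_nonneg _).trans hε)
  have hJ := norm_J_sub_approx_sq_le hA hσ hp hx hy hε
  have hux : ‖u - x‖ ^ 2 ≤ (D + D) ^ 2 := by
    gcongr
    exact norm_sub_le_add hu hx
  have e : y' - x = lam • (u - x) + gam • (y - x) + del • (J A σ y - x) := by
    have : x = (lam + gam + del) • x := by rw [hsum, one_smul]
    rw [hy']
    nth_rw 1 [this]
    module
  have hconv : ‖y' - x‖ ^ 2
      ≤ lam * ‖u - x‖ ^ 2 + gam * ‖y - x‖ ^ 2 + del * ‖J A σ y - x‖ ^ 2 := by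
    have h1 : ‖y' - x‖ ≤ lam * ‖u - x‖ + gam * ‖y - x‖ + del * ‖J A σ y - x‖ := by
      rw [e]
      refine (norm_add₃_le).trans_eq ?_
      rw [norm_smul, norm_smul, norm_smul, Real.norm_of_nonneg hlam, Real.norm_of_nonneg hgam,
        Real.norm_of_nonneg hdel]
    have h2 : ‖y' - x‖ ^ 2
        ≤ (lam * ‖u - x‖ + gam * ‖y - x‖ + del * ‖J A σ y - x‖) ^ 2 := by gcongr
    refine h2.trans ?_
    set a := ‖u - x‖
    set b := ‖y - x‖
    set d := ‖J A σ y - x‖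
    have h3 : lam * a ^ 2 + gam * b ^ 2 + del * d ^ 2 - (lam * a + gam * b + del * d) ^ 2
        = lam * gam * (a - b) ^ 2 + lam * del * (a - d) ^ 2 + gam * del * (b - d) ^ 2 := by
      have : lam = 1 - gam - del := by linarith
      rw [this]
      ring
    have : 0 ≤ lam * gam * (a - b) ^ 2 + lam * del * (a - d) ^ 2 + gam * del * (b - d) ^ 2 := by
      positivity
    linarith
  have h1 := mul_le_mul_of_nonneg_left hux hlam
  have h2 := mul_le_mul_of_nonneg_left hJ hdel
  have h3 : del * (6 * D * ε) ≤ 1 * (6 * D * ε) := by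
    gcongr
    linarith
  have h4 : (gam + del) * ‖y - x‖ ^ 2 ≤ 1 * ‖y - x‖ ^ 2 := by
    gcongr
    linarith
  linarith

end Step

/-! ### Monotonicity of the bounds, and real sequences -/

section Bounds

lemma cast_sub_one_add_one {a : ℕ} (ha : 0 < a) : ((a - 1 : ℕ) : ℝ) + 1 = a := by
  rw [Nat.cast_sub ha]
  simp

lemma fTildeTwo_monotone {f L : ℕ → ℕ} (hf : Monotone f) (hL : Monotone L) (k D : ℕ) :
    Monotone (fTildeTwo k f L D) := by
  intro a b hab
  simp only [fTildeTwo, fTilde, sigmaBar]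
  have : L (a + ⌈Real.log (12 * (D : ℝ) ^ 2 * ((k : ℝ) + 1))⌉₊)
      ≤ L (b + ⌈Real.log (12 * (D : ℝ) ^ 2 * ((k : ℝ) + 1))⌉₊) := hL (by omega)
  have := hf (Nat.add_le_add_right this 1)
  omega

lemma phi2_mono {g : ℕ → ℕ} (hg : Monotone g) (D : ℕ) {i i' n n' : ℕ} (hi : i ≤ i')
    (hn : n ≤ n') : phi2 D i n g ≤ phi2 D i' n' g := by
  have h1 : phi2 D i n g ≤ phi2 D i' n g := by
    rcases le_total n (g n) with h | h
    · exact max_le_max le_rfl (hg.monotone_iterate_of_le_map h (by gcongr))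
    · refine max_le (le_max_left _ _) (le_max_of_le_left ?_)
      simpa using hg.antitone_iterate_of_map_le h (Nat.zero_le (4 * D ^ 2 * (i + 1)))
  exact h1.trans (max_le_max hn (hg.iterate _ hn))

lemma r1_mono (c : ℕ) : Monotone (r1 c) := fun a b hab =>
  Nat.sub_le_sub_right (by gcongr) 1

lemma r3_mono (k c D : ℕ) {l : ℕ → ℕ} (hl : Monotone l) : Monotone (r3 k c l D) := by
  intro a b hab
  have : r2 k D a ≤ r2 k D b := max_le_max (by gcongr) le_rfl
  exact hl (max_le_max (max_le_max (Nat.sub_le_sub_right (by gcongr) 1) le_rfl) (by gcongr))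

/-- Metastability of a bounded sequence that decreases on a sufficiently long interval. -/
lemma exists_phi2_stable {s : ℕ → ℝ} {D : ℕ} (hD : 0 < D) (h0 : ∀ n, 0 ≤ s n)
    (hs : ∀ n, s n ≤ 4 * (D : ℝ) ^ 2) {g : ℕ → ℕ} (hg : Monotone g) (i N : ℕ)
    (hdec : ∀ j, N ≤ j → j < phi1 D i N g → s (j + 1) ≤ s j) :
    ∃ m, N ≤ m ∧ m ≤ phi2 D i N g ∧ g m ≤ phi1 D i N g ∧
      ∀ j j', m ≤ j → j ≤ j' → j' ≤ g m → s j - s j' ≤ 1 / ((i : ℝ) + 1) := by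
  rcases lt_or_ge (g N) N with hN | hN
  · exact ⟨N, le_rfl, le_max_left _ _, hg (le_max_left _ _), fun j j' h1 h2 h3 => by omega⟩
  have hit : Monotone fun a => g^[a] N := hg.monotone_iterate_of_le_map hN
  obtain ⟨a, haR, ha⟩ := exists_step_le (fun a => -s (g^[a] N)) (R := 4 * D ^ 2 * (i + 1))
    (by positivity) (B := 4 * (D : ℝ) ^ 2) (by
      have := h0 (g^[4 * D ^ 2 * (i + 1)] N)
      have := hs (g^[0] N)
      linarith)
  have hm : g^[a] N ≤ phi2 D i N g := le_max_of_le_right (hit haR.le)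
  have hNm : N ≤ g^[a] N := hit (Nat.zero_le a)
  refine ⟨g^[a] N, hNm, hm, hg hm, fun j j' h1 h2 h3 => ?_⟩
  have hanti : ∀ q q', g^[a] N ≤ q → q ≤ q' → q' ≤ g (g^[a] N) → s q' ≤ s q := by
    intro q q' hq hqq'
    induction q', hqq' using Nat.le_induction with
    | base => exact fun _ => le_rfl
    | succ r hr ih =>
      intro hle
      exact (hdec r (by omega) (lt_of_lt_of_le hle (hg hm))).trans (ih (by omega))
  have h4 := hanti _ j le_rfl h1 (h2.trans h3)
  have h5 := hanti j' _ (h1.trans h2) h3 le_rfl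
  simp only [Function.iterate_succ_apply'] at ha
  have e : 4 * (D : ℝ) ^ 2 / ((4 * D ^ 2 * (i + 1) : ℕ) : ℝ) = 1 / ((i : ℝ) + 1) := by
    push_cast
    field_simp
  linarith

/-- After an increase at `j₀`, every term is dominated by the term just after the last increase
that precedes it. -/
lemma exists_last_increase {s : ℕ → ℝ} {j₀ i : ℕ} (hj : s j₀ < s (j₀ + 1)) (hi : j₀ + 1 ≤ i) :
    ∃ τ, j₀ ≤ τ ∧ τ < i ∧ s τ < s (τ + 1) ∧ s i ≤ s (τ + 1) := by
  induction i, hi using Nat.le_induction with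
  | base => exact ⟨j₀, le_rfl, j₀.lt_succ_self, hj, le_rfl⟩
  | succ n hn ih =>
    rcases lt_or_ge (s n) (s (n + 1)) with h | h
    · exact ⟨n, by omega, n.lt_succ_self, h, le_rfl⟩
    · obtain ⟨τ, h1, h2, h3, h4⟩ := ih
      exact ⟨τ, h1, by omega, h3, h.trans h4⟩

end Bounds

/-! ### Metastability of the exact iteration -/

section Exact

/-- The iterates behind `phi1` increase strictly until they reach a fixed point of `g`, so `phi1` is
at least their number unless it is such a fixed point. -/
lemma le_phi1_of_lt {g : ℕ → ℕ} (hg : Monotone g) {D i N : ℕ} (h1 : N < phi1 D i N g)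
    (h2 : phi1 D i N g < g (phi1 D i N g)) : 4 * D ^ 2 * (i + 1) ≤ phi1 D i N g := by
  have hN : N ≤ g N := by
    by_contra! hlt
    have hR : g^[4 * D ^ 2 * (i + 1)] N ≤ N := by
      simpa using hg.antitone_iterate_of_map_le hlt.le (Nat.zero_le (4 * D ^ 2 * (i + 1)))
    rw [phi1, phi2, max_eq_left hR] at h1
    omega
  have hit : Monotone fun a => g^[a] N := hg.monotone_iterate_of_le_map hN
  have hφ : phi2 D i N g = g^[4 * D ^ 2 * (i + 1)] N :=
    max_eq_right (by simpa using hit (Nat.zero_le (4 * D ^ 2 * (i + 1))))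
  have hdich : ∀ a, g (g^[a] N) = g^[a] N ∨ a ≤ g^[a] N := by
    intro a
    induction a with
    | zero => exact Or.inr (Nat.zero_le _)
    | succ a ih =>
      have hle : g^[a] N ≤ g^[a + 1] N := hit (Nat.le_succ a)
      rw [Function.iterate_succ_apply'] at hle ⊢
      rcases ih with h | h
      · left
        rw [h, h]
      · rcases hle.eq_or_lt with h' | h'
        · left
          rw [← h', ← h']
        · right
          omega
  rw [phi1, hφ] at h2 ⊢
  rcases hdich (4 * D ^ 2 * (i + 1)) with h | h
  · rw [h, h] at h2
    exact absurd h2 (lt_irrefl _)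
  · refine h.trans ?_
    have := hit (Nat.le_succ (4 * D ^ 2 * (i + 1)))
    simpa only [Function.iterate_succ_apply'] using this

lemma le_of_mul_sq_le {a b c δ B : ℝ} (hc : 0 ≤ c) (hcδ : 1 ≤ c * δ) (h : δ * a ^ 2 ≤ B)
    (hB : c * B ≤ b ^ 2) (hb : 0 ≤ b) : a ≤ b := by
  refine le_of_sq_le_sq ?_ hb
  have h1 := mul_le_mul_of_nonneg_left h hc
  have h2 := mul_le_mul_of_nonneg_right hcδ (sq_nonneg a)
  linarith

variable {H : Type*} [NormedAddCommGroup H] [InnerProductSpace ℝ H] [CompleteSpace H]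
  {A : H → Set H}

/-- The meaning of `zeta`: a precision for `J_{1/c}` that suffices for every `J_{c_j}` with
`j ≤ n`. -/
lemma norm_sub_J_le_of_zeta_le (hA : IsMaximalMonotoneOp A) {cs : ℕ → ℝ} {c : ℕ} (hc : 0 < c)
    (hccs : ∀ n, 1 / (c : ℝ) ≤ cs n) {C : ℕ → ℕ} (hCmono : Monotone C)
    (hC : ∀ n, cs n ≤ (C n : ℝ)) {x : H} {X : ℕ}
    (hx : ‖x - J A (1 / (c : ℝ)) x‖ ≤ 1 / ((X : ℝ) + 1)) {i n j : ℕ}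
    (hX : zeta c C i n ≤ X) (hj : j ≤ n) :
    ‖x - J A (cs j) x‖ ≤ 1 / ((i : ℝ) + 1) := by
  have hc' : (0 : ℝ) < c := by exact_mod_cast hc
  have hpos : ∀ n, 0 < cs n := fun n => lt_of_lt_of_le (by positivity) (hccs n)
  have hCn : (0 : ℝ) < C n := (hpos n).trans_le (hC n)
  have hCn' : 0 < C n := by exact_mod_cast hCn
  have hz : ((zeta c C i n : ℕ) : ℝ) + 1 = c * ((i : ℝ) + 1) * C n := by
    rw [zeta, cast_sub_one_add_one (by positivity)]
    push_cast
    ring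
  have hx' : ‖x - J A (1 / (c : ℝ)) x‖ ≤ 1 / (c * ((i : ℝ) + 1) * C n) := by
    rw [← hz]
    refine hx.trans ?_
    gcongr
  have hcj : cs j ≤ C n := (hC j).trans (by exact_mod_cast hCmono hj)
  calc ‖x - J A (cs j) x‖ ≤ cs j / (1 / (c : ℝ)) * ‖x - J A (1 / (c : ℝ)) x‖ :=
        (norm_sub_J_compare hA (by positivity) (hccs j) x).2
    _ ≤ C n / (1 / (c : ℝ)) * (1 / (c * ((i : ℝ) + 1) * C n)) := by gcongr
    _ = 1 / ((i : ℝ) + 1) := by field_simp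

set_option maxHeartbeats 1000000 in
/-- Metastability of the exact iteration around an approximate projection `x` of `u`. Either the
distance to `x` decreases on the interval from `r3` to `Phi`, and then it is almost constant on a
long subinterval, so that the resolvents move the points of the iteration little and the
contraction inequality applies; or it increases somewhere there, and then the contraction
inequality is used at the last increase. -/
theorem exists_mu_norm_sub_sq_le (hA : IsMaximalMonotoneOp A) {lam gam del cs : ℕ → ℝ}
    (hlam0 : ∀ n, 0 < lam n) (hlam1 : ∀ n, lam n ≤ 1) (hdel : ∀ n, 0 ≤ del n)
    (hdel1 : ∀ n, del n ≤ 1) (hgam : ∀ n, 0 ≤ gam n) (hsum : ∀ n, lam n + gam n + del n = 1)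
    {u : H} {y : ℕ → H} (hy : IsIteration A u lam gam del cs 0 y)
    {c : ℕ} (hc : 0 < c) {h l L : ℕ → ℕ} (hhpos : ∀ n, 0 < h n)
    (hhmono : Monotone h) (hlmono : Monotone l) (hLmono : Monotone L)
    (hQ1 : ∀ n, 1 / (h n : ℝ) ≤ lam n)
    (hQ2 : ∀ k n : ℕ, l k ≤ n → lam n ≤ 1 / ((k : ℝ) + 1))
    (hQ3 : ∀ k : ℕ, (k : ℝ) ≤ ∑ i ∈ Finset.Icc 1 (L k), lam i)
    (hccs : ∀ n, 1 / (c : ℝ) ≤ cs n) (hcdel : ∀ n, 1 / (c : ℝ) ≤ del n)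
    {D : ℕ} (hDpos : 0 < D) {p : H} (hp : p ∈ zeros A) (hu2 : 2 * ‖u - p‖ ≤ D)
    (hy0 : ‖y 0 - p‖ ≤ D) {C : ℕ → ℕ} (hCmono : Monotone C) (hC : ∀ n, cs n ≤ (C n : ℝ))
    (k : ℕ) {f : ℕ → ℕ} (hf : Monotone f) :
    ∃ x : H, ∃ n ≤ mu c C l L h D k f,
      ∀ i ∈ Set.Icc n (f n), ‖y i - x‖ ^ 2 ≤ 1 / ((k : ℝ) + 1) := by
  have hc' : (0 : ℝ) < c := by exact_mod_cast hc
  have hD1 : (1 : ℝ) ≤ D := by exact_mod_cast hDpos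
  have hcs : ∀ n, 0 < cs n := fun n => lt_of_lt_of_le (by positivity) (hccs n)
  have hc0 : (0 : ℝ) < 1 / (c : ℝ) := by positivity
  have hcδ : ∀ n, 1 ≤ c * del n := fun n => by
    have := (div_le_iff₀ hc').1 (hcdel n)
    linarith
  have hup : ‖u - p‖ ≤ D := by
    have := norm_nonneg (u - p)
    linarith
  have hyp : ∀ n, ‖y n - p‖ ≤ D :=
    hy.norm_sub_le hA hcs (fun n => (hlam0 n).le) hgam hdel hsum hp hup hy0
  have hiter : ∀ n, y (n + 1) = lam n • u + gam n • y n + del n • J A (cs n) (y n) := fun n => by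
    rw [hy n, Pi.zero_apply, add_zero]
  obtain ⟨η, hη, x, hxp, hxJ, hproj⟩ := exists_approx_projection
    (T := J A (1 / (c : ℝ))) (norm_J_sub_le hA hc0) (J_eq_self hA hc0 hp) hDpos hu2
    (32 * (k + 1) ^ 2 - 1) (Xi k f c C l L D h)
  have hk32 : ((32 * (k + 1) ^ 2 - 1 : ℕ) : ℝ) + 1 = 32 * ((k : ℝ) + 1) ^ 2 := by
    rw [cast_sub_one_add_one (by positivity)]
    push_cast
    ring
  rw [hk32] at hproj
  have hηb : η ≤ betaXi c C l L h D k f := hη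
  set b := betaXi c C l L h D k f with hb
  set g := fTildeTwo k f L D with hg
  have hgmono : Monotone g := fTildeTwo_monotone hf hLmono k D
  set R1 := r1 c η with hR1
  set R3 := r3 k c l D η with hR3
  set F := Phi k c f l L D η with hF
  have hphi : phi2 D R1 R3 g ≤ phi2 D (r1 c b) (r3 k c l D b) g :=
    phi2_mono hgmono D (r1_mono c hηb) (r3_mono k c D hlmono hηb)
  have hFb : F ≤ Phi k c f l L D b := hgmono hphi
  have hP : (1 : ℝ) ≤ (k : ℝ) + 1 := by
    have : (0 : ℝ) ≤ k := Nat.cast_nonneg k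
    linarith
  have hQ : (1 : ℝ) ≤ (η : ℝ) + 1 := by
    have : (0 : ℝ) ≤ η := Nat.cast_nonneg η
    linarith
  set P : ℝ := (k : ℝ) + 1 with hPdef
  set Q : ℝ := (η : ℝ) + 1 with hQdef
  have hR1' : (R1 : ℝ) + 1 = 12 * c * Q ^ 2 := by
    rw [hR1, r1, cast_sub_one_add_one (by positivity)]
    push_cast
    ring
  have hsmall : ∀ K j : ℕ, l K ≤ R3 → R3 ≤ j → lam j ≤ 1 / ((K : ℝ) + 1) := fun K j h1 h2 =>
    hQ2 K j (h1.trans h2)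
  set s : ℕ → ℝ := fun n => ‖y n - x‖ ^ 2 with hs
  have hs0 : ∀ n, 0 ≤ s n := fun n => sq_nonneg _
  have hs4 : ∀ n, s n ≤ 4 * (D : ℝ) ^ 2 := fun n => by
    have h1 := norm_sub_le_add (hyp n) hxp
    have : s n ≤ ((D : ℝ) + D) ^ 2 := by simp only [hs]; gcongr
    linarith
  -- the one-step estimates at index `n`, for any bound `ε` on the displacement of `x`
  have hstepJ := fun (n : ℕ) {ε : ℝ} (hε : ‖x - J A (cs n) x‖ ≤ ε) =>
    step_norm_sub_J_sq_le hA (hcs n) (hlam0 n).le (hgam n) (hdel n) (hsum n) (hiter n) hp hup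
      hxp (hyp n) hε
  have hstep := fun (n : ℕ) {ε : ℝ} (hε : ‖x - J A (cs n) x‖ ≤ ε) =>
    step_norm_sq_le hA (hcs n) (hlam0 n).le (hgam n) (hdel n) (hsum n) (hiter n) hp hxp
      (hyp n) hε
  by_cases hdec : ∀ j, R3 ≤ j → j < F → s (j + 1) ≤ s j
  · obtain ⟨m, hRm, hm2, hgm, hstab⟩ := exists_phi2_stable hDpos hs0 hs4 hgmono R1 R3 hdec
    change g m ≤ F at hgm
    have hgm' : g m = fTilde k f L D m + 2 := rfl
    set q := fTilde k f L D m with hq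
    set R4 := r4 k c f l D L η with hR4
    set W : ℝ := ((max R1 R4 : ℕ) : ℝ) with hW
    have hR1pos : 1 ≤ R1 := by
      have : (12 : ℝ) * 1 * 1 ≤ 12 * c * Q ^ 2 := by
        have : (1 : ℝ) ≤ c := by exact_mod_cast hc
        gcongr
        nlinarith
      have : (1 : ℝ) ≤ R1 := by linarith
      exact_mod_cast this
    have hR1W : (R1 : ℝ) ≤ W := Nat.cast_le.2 (le_max_left R1 R4)
    have hR4W : (R4 : ℝ) ≤ W := Nat.cast_le.2 (le_max_right R1 R4)
    have hR1r : (1 : ℝ) ≤ R1 := by exact_mod_cast hR1pos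
    have hWpos : 0 < W := by linarith
    have hε : ∀ j ≤ F, ‖x - J A (cs j) x‖ ≤ 1 / (2 * (6 * D + 1) * W) := by
      intro j hj
      have h1 := norm_sub_J_le_of_zeta_le hA hc hccs hCmono hC hxJ
        (show zeta c C (2 * (6 * D + 1) * max R1 R4 - 1) F ≤ Xi k f c C l L D h η from
          le_max_left _ _) hj
      rw [cast_sub_one_add_one (Nat.mul_pos (by positivity)
        (lt_of_lt_of_le hR1pos (le_max_left _ _)))] at h1
      simpa only [hW, Nat.cast_mul, Nat.cast_add, Nat.cast_ofNat, Nat.cast_one] using h1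
    have h6ε : 6 * (D : ℝ) * (1 / (2 * (6 * D + 1) * W)) ≤ 1 / (2 * W) := by
      rw [mul_one_div, div_le_div_iff₀ (by positivity) (by positivity)]
      nlinarith
    -- near `m` the distances are almost constant, so the `y j` are approximate zeros and the
    -- variational inequality of the projection point applies to them
    have hnear : ∀ j, m ≤ j → j ≤ q + 1 →
        inner ℝ (u - x) (y j - x) ≤ 1 / (32 * P ^ 2) := by
      intro j hmj hjq
      refine hproj _ (hyp j) (le_trans (norm_sub_J_compare hA hc0 (hccs j) (y j)).1 ?_)
      have h1 := hstepJ j (hε j (by omega))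
      have h2 := hstab j (j + 1) hmj (by omega) (by omega)
      have h3 : 1 / (2 * W) ≤ 1 / ((R1 : ℝ) + 1) := by gcongr; linarith
      have h4 : lam j ≤ 1 / (96 * c * D ^ 2 * Q ^ 2) := by
        have := hsmall (96 * c * D ^ 2 * (η + 1) ^ 2 - 1) j
          (hlmono (le_max_of_le_left (le_max_left _ _))) (hRm.trans hmj)
        rw [cast_sub_one_add_one (by positivity)] at this
        simpa only [hQdef, Nat.cast_mul, Nat.cast_add, Nat.cast_ofNat, Nat.cast_one,
          Nat.cast_pow] using this
      refine le_of_mul_sq_le hc'.le (hcδ j) (h1.trans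
        (show _ ≤ 1 / (12 * c * Q ^ 2) + 4 * (D : ℝ) ^ 2 * (1 / (96 * c * D ^ 2 * Q ^ 2))
          + 1 / (12 * c * Q ^ 2) from ?_)) ?_ (by positivity)
      · rw [hR1'] at h2 h3
        have := mul_le_mul_of_nonneg_left h4 (show 0 ≤ 4 * (D : ℝ) ^ 2 by positivity)
        simp only [hs] at h2
        linarith
      · have e : c * (1 / (12 * c * Q ^ 2) + 4 * (D : ℝ) ^ 2 * (1 / (96 * c * D ^ 2 * Q ^ 2))
          + 1 / (12 * c * Q ^ 2)) = 5 / 24 * (1 / Q) ^ 2 := by field_simp; norm_num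
        rw [e]
        have : 0 ≤ (1 / Q) ^ 2 := by positivity
        linarith
    refine ⟨x, sigmaBar L D k m, ?_, fun i hi => ?_⟩
    · refine le_trans ?_ (le_max_left _ _)
      exact Nat.add_le_add_right (hLmono (Nat.add_le_add_right (hm2.trans hphi) _)) 1
    · obtain ⟨hi1, hi2⟩ := hi
      have hiq : i ≤ q := hi2
      have hmi : m ≤ i := by
        have := le_rate hlam1 hQ3 (m + ⌈Real.log (12 * (D : ℝ) ^ 2 * ((k : ℝ) + 1))⌉₊)
        rw [sigmaBar] at hi1
        omega
      have hrec := le_exp_neg_sum_mul_add (s := s) (v := fun _ => 1 / (2 * W))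
        (b := 1 / (16 * P ^ 2)) hmi (fun j => (hlam0 j).le) hlam1 (fun _ => by positivity)
        (by positivity : (0 : ℝ) ≤ 4 * (D : ℝ) ^ 2) (by positivity) (hs4 m) (fun j hj hji => by
          have h1 := hstep j (hε j (by omega))
          have h2 := mul_le_mul_of_nonneg_left (hnear (j + 1) (by omega) (by omega))
            (by have := hlam0 j; positivity : 0 ≤ 2 * lam j)
          have e : 2 * lam j * (1 / (32 * P ^ 2)) = lam j * (1 / (16 * P ^ 2)) := by
            field_simp
            ring
          simp only [hs]
          linarith)
      have hexp := exp_neg_sum_le (fun j => (hlam0 j).le) hlam1 hQ3 (N := m) (N' := m)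
        (by omega) (X := 12 * (D : ℝ) ^ 2 * P) (by positivity) hi1
      -- the three contributions to `s i`: initial value, inner products, accumulated errors
      have t1 : Real.exp (-∑ j ∈ Finset.Ico m i, lam j) * (4 * (D : ℝ) ^ 2) ≤ 1 / 3 * (1 / P) := by
        calc _ ≤ 1 / (12 * (D : ℝ) ^ 2 * P) * (4 * (D : ℝ) ^ 2) := by gcongr
          _ = 1 / 3 * (1 / P) := by field_simp; norm_num
      have t2 : 1 / (16 * P ^ 2) ≤ 1 / 3 * (1 / P) := by
        rw [div_mul_div_comm, one_mul, div_le_div_iff₀ (by positivity) (by positivity)]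
        nlinarith
      have t3 : ∑ j ∈ Finset.Ico m i, 1 / (2 * W) ≤ 1 / 3 * (1 / P) := by
        rw [Finset.sum_const, Nat.card_Ico, nsmul_eq_mul]
        have hq4 : 3 * (k + 1) * (i - m) ≤ R4 := by
          have h1 : q ≤ fTilde k f L D (phi2 D R1 R3 g) := by
            have := hgmono hm2
            simp only [hg, fTildeTwo] at this
            exact Nat.le_of_add_le_add_right this
          rw [hR4, r4]
          refine Nat.mul_le_mul le_rfl ?_
          change i - m ≤ fTilde k f L D (phi2 D R1 R3 g) + 1
          omega
        have hq4' : 3 * P * ((i - m : ℕ) : ℝ) ≤ W := by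
          refine le_trans ?_ hR4W
          rw [hPdef]
          exact_mod_cast hq4
        rw [mul_one_div, div_mul_div_comm, one_mul, div_le_div_iff₀ (by positivity)
          (by positivity)]
        linarith
      have : s i ≤ 1 / P := by linarith
      exact this
  · push Not at hdec
    obtain ⟨j₀, hRj, hjF, hinc⟩ := hdec
    refine ⟨x, F, hFb.trans (le_max_right _ _), fun i hi => ?_⟩
    obtain ⟨hi1, hi2⟩ := hi
    obtain ⟨τ, hjτ, hτi, hτinc, hτ⟩ := exists_last_increase hinc (show j₀ + 1 ≤ i by omega)
    refine hτ.trans ?_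
    -- the interval `[F, f F]` is nonempty, so `F` is not a fixed point of `g`
    have hηF : η ≤ F := by
      have hgF : F < g F := by
        have h1 := le_rate hlam1 hQ3 (F + ⌈Real.log (12 * (D : ℝ) ^ 2 * ((k : ℝ) + 1))⌉₊)
        have h2 : f F ≤ f (sigmaBar L D k F) := hf (by rw [sigmaBar]; omega)
        rw [hg, fTildeTwo, fTilde]
        omega
      have h1 : 4 * D ^ 2 * (R1 + 1) ≤ F := le_phi1_of_lt hgmono (hRj.trans_lt hjF) hgF
      have h2 : η ≤ R1 := by
        have : 12 * 1 * (η + 1) ^ 2 ≤ 12 * c * (η + 1) ^ 2 := by gcongr; exact hc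
        rw [hR1, r1]
        have : η + 1 ≤ (η + 1) ^ 2 := Nat.le_self_pow two_ne_zero _
        omega
      have h3 : 1 * (R1 + 1) ≤ 4 * D ^ 2 * (R1 + 1) := by
        gcongr
        have : 0 < D ^ 2 := by positivity
        omega
      omega
    set R2 := r2 k D η with hR2
    -- `xi` evaluates `r2` at `F`, whereas the projection point requires it at `η`
    have hR2F : R2 ≤ r2 k D F := max_le_max (by gcongr) le_rfl
    have hR2η : 2 * (η + 1) ≤ R2 := le_max_left _ _
    have hR2D : 128 * D * (k + 1) ^ 2 ≤ R2 := le_max_right _ _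
    set N := max (16 * h (f F) * (k + 1) ^ 2 * (6 * D + 1))
      (4 * c * (r2 k D F) ^ 2 * (6 * D + 1)) with hN
    set ε : ℝ := 1 / ((N : ℝ) + 1) with hε
    have hεx : ‖x - J A (cs τ) x‖ ≤ ε :=
      norm_sub_J_le_of_zeta_le hA hc hccs hCmono hC hxJ
        (show zeta c C N (f F) ≤ Xi k f c C l L D h η from le_max_right _ _)
        (show τ ≤ f F by omega)
    have hε0 : 0 < ε := by positivity
    have hεN : ∀ a : ℕ, a * (6 * D + 1) ≤ N → a * (6 * D * ε) ≤ 1 := by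
      intro a ha
      have ha' : (a : ℝ) * (6 * D + 1) ≤ N := by exact_mod_cast ha
      rw [hε, mul_one_div, mul_div_assoc', div_le_one (by positivity)]
      have : (0 : ℝ) ≤ a := Nat.cast_nonneg a
      linarith
    have hε1 : 16 * (h (f F) : ℝ) * P ^ 2 * (6 * D * ε) ≤ 1 := by
      have := hεN (16 * h (f F) * (k + 1) ^ 2) (le_max_left _ _)
      simpa only [hPdef, Nat.cast_mul, Nat.cast_add, Nat.cast_ofNat, Nat.cast_one,
          Nat.cast_pow] using this
    have hε2 : 4 * (c : ℝ) * (R2 : ℝ) ^ 2 * (6 * D * ε) ≤ 1 := by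
      have := hεN (4 * c * R2 ^ 2) (le_trans (by gcongr) (le_max_right _ _))
      simpa only [Nat.cast_mul, Nat.cast_add, Nat.cast_ofNat, Nat.cast_one,
          Nat.cast_pow] using this
    have hRτ : R3 ≤ τ := hRj.trans hjτ
    have hlam2 : lam τ * (16 * c * (R2 : ℝ) ^ 2 * D ^ 2) ≤ 1 := by
      have h1 := hsmall (16 * c * R2 ^ 2 * D ^ 2) τ (hlmono (le_max_right _ _)) hRτ
      rw [le_div_iff₀ (by positivity)] at h1
      push_cast at h1
      linarith [hlam0 τ]
    have hlam3 : lam τ * (256 * (D : ℝ) ^ 2 * P ^ 2) ≤ 1 := by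
      have h1 := hsmall (256 * D ^ 2 * (k + 1) ^ 2 - 1) τ
        (hlmono (le_max_of_le_left (le_max_right _ _))) hRτ
      rw [cast_sub_one_add_one (by positivity), le_div_iff₀ (by positivity)] at h1
      push_cast at h1
      exact h1
    have hR2pos : (0 : ℝ) < R2 := by exact_mod_cast (by omega : 0 < R2)
    have hJτ : ‖y τ - J A (cs τ) (y τ)‖ ≤ 1 / R2 := by
      refine le_of_mul_sq_le hc'.le (hcδ τ) ((hstepJ τ hεx).trans
        (show _ ≤ 4 * (D : ℝ) ^ 2 * lam τ + 6 * D * ε from ?_)) ?_ (by positivity)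
      · simp only [hs] at hτinc
        linarith
      · rw [div_pow, one_pow, le_div_iff₀ (by positivity)]
        linarith
    have hnear : inner ℝ (u - x) (y τ - x) ≤ 1 / (32 * P ^ 2) := by
      refine hproj _ (hyp τ) (((norm_sub_J_compare hA hc0 (hccs τ) (y τ)).1.trans hJτ).trans ?_)
      have : 2 * Q ≤ R2 := by rw [hQdef]; exact_mod_cast hR2η
      gcongr
      linarith
    -- the variational inequality holds at `y τ`; the step to `y (τ + 1)` is small enough to
    -- transfer it
    have hmove : ‖y (τ + 1) - y τ‖ ≤ 1 / (64 * D * P ^ 2) := by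
      have e : y (τ + 1) - y τ = lam τ • (u - y τ) - del τ • (y τ - J A (cs τ) (y τ)) := by
        have : y τ = (lam τ + gam τ + del τ) • y τ := by rw [hsum, one_smul]
        rw [hiter]
        nth_rw 3 [this]
        module
      have h1 : lam τ * ‖u - y τ‖ ≤ lam τ * (D + D) :=
        mul_le_mul_of_nonneg_left (norm_sub_le_add hup (hyp τ)) (hlam0 τ).le
      have h2 : del τ * ‖y τ - J A (cs τ) (y τ)‖ ≤ 1 * (1 / R2) :=
        mul_le_mul (hdel1 τ) hJτ (norm_nonneg _) zero_le_one
      have h3 : 1 / (R2 : ℝ) ≤ 1 / (128 * D * P ^ 2) := by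
        have : 128 * (D : ℝ) * P ^ 2 ≤ R2 := by rw [hPdef]; exact_mod_cast hR2D
        gcongr
      have h4 : lam τ * (D + D) ≤ 1 / (128 * D * P ^ 2) := by
        rw [le_div_iff₀ (by positivity)]
        linarith
      have h5 : 1 / (64 * (D : ℝ) * P ^ 2) = 2 * (1 / (128 * D * P ^ 2)) := by
        field_simp
        norm_num
      rw [e]
      refine (norm_sub_le _ _).trans ?_
      rw [norm_smul, norm_smul, Real.norm_of_nonneg (hlam0 τ).le, Real.norm_of_nonneg (hdel τ)]
      linarith
    have hinner : inner ℝ (u - x) (y (τ + 1) - x) ≤ 1 / (16 * P ^ 2) := by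
      have e : y (τ + 1) - x = (y τ - x) + (y (τ + 1) - y τ) := by abel
      have h1 : inner ℝ (u - x) (y (τ + 1) - y τ) ≤ (D + D) * (1 / (64 * D * P ^ 2)) :=
        (real_inner_le_norm _ _).trans
          (mul_le_mul (norm_sub_le_add hup hxp) hmove (norm_nonneg _) (by positivity))
      have h2 : ((D : ℝ) + D) * (1 / (64 * D * P ^ 2)) + 1 / (32 * P ^ 2) = 1 / (16 * P ^ 2) := by
        field_simp
        norm_num
      rw [e, inner_add_right]
      linarith
    have hεlam : 6 * D * ε ≤ lam τ * (1 / (16 * P ^ 2)) := by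
      have hh : (0 : ℝ) < h τ := by exact_mod_cast hhpos τ
      have hhle : (h τ : ℝ) ≤ h (f F) := by exact_mod_cast hhmono (show τ ≤ f F by omega)
      have h1 : 1 ≤ lam τ * h τ := (div_le_iff₀ hh).1 (hQ1 τ)
      have h2 : lam τ * h τ ≤ lam τ * h (f F) := mul_le_mul_of_nonneg_left hhle (hlam0 τ).le
      have h3 := mul_le_mul_of_nonneg_left hε1 (hlam0 τ).le
      have h4 : 1 * (16 * P ^ 2 * (6 * D * ε)) ≤ lam τ * h (f F) * (16 * P ^ 2 * (6 * D * ε)) :=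
        mul_le_mul_of_nonneg_right (h1.trans h2) (by positivity)
      rw [mul_one_div (lam τ), le_div_iff₀ (by positivity)]
      linarith
    -- as `s τ < s (τ + 1)`, the contraction inequality bounds `lam τ * s (τ + 1)`
    have hfin := hstep τ hεx
    have h1 := mul_le_mul_of_nonneg_left hinner
      (by have := hlam0 τ; positivity : 0 ≤ 2 * lam τ)
    have h2 := mul_le_mul_of_nonneg_left hτinc.le (sub_nonneg.2 (hlam1 τ))
    have h3 : lam τ * s (τ + 1) ≤ lam τ * (3 * (1 / (16 * P ^ 2))) := by
      simp only [hs] at h2 ⊢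
      linarith
    refine (le_of_mul_le_mul_left h3 (hlam0 τ)).trans ?_
    rw [mul_one_div, div_le_div_iff₀ (by positivity) (by positivity)]
    nlinarith

end Exact

/-! ### Comparison with the exact iteration -/

section Perturbation

variable {H : Type*} [NormedAddCommGroup H] [InnerProductSpace ℝ H] [CompleteSpace H]
  {A : H → Set H} {lam gam del cs : ℕ → ℝ} {u : H} {e z y : ℕ → H}

lemma IsIteration.norm_sub_succ_le (hA : IsMaximalMonotoneOp A) (hcs : ∀ n, 0 < cs n)
    (hgam : ∀ n, 0 ≤ gam n) (hdel : ∀ n, 0 ≤ del n) (hsum : ∀ n, lam n + gam n + del n = 1)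
    (hz : IsIteration A u lam gam del cs e z) (hy : IsIteration A u lam gam del cs 0 y) (n : ℕ) :
    ‖z (n + 1) - y (n + 1)‖ ≤ (1 - lam n) * ‖z n - y n‖ + ‖e n‖ := by
  have h : z (n + 1) - y (n + 1) = gam n • (z n - y n)
      + del n • (J A (cs n) (z n) - J A (cs n) (y n)) + e n := by
    rw [hz n, hy n, Pi.zero_apply]
    module
  rw [h]
  refine (norm_add₃_le).trans ?_
  rw [norm_smul, norm_smul, Real.norm_of_nonneg (hgam n), Real.norm_of_nonneg (hdel n)]
  have h1 := mul_le_mul_of_nonneg_left (norm_J_sub_le hA (hcs n) (z n) (y n)) (hdel n)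
  rw [show 1 - lam n = gam n + del n by linarith [hsum n], add_mul]
  linarith

/-- `Theta` is a rate of convergence to `0` for sequences that satisfy the recursive inequality of
the distance between the inexact and the exact iteration. -/
theorem le_of_Theta_le {s ε : ℕ → ℝ} (hs0 : ∀ n, 0 ≤ s n) (hε : ∀ n, 0 ≤ ε n)
    (hl0 : ∀ n, 0 < lam n) (hl1 : ∀ n, lam n ≤ 1)
    (hs : ∀ n, s (n + 1) ≤ (1 - lam n) * s n + ε n) (hsz : s 0 = 0)
    {L E : ℕ → ℕ} (hE : Monotone E)
    (hQ3 : ∀ k : ℕ, (k : ℝ) ≤ ∑ i ∈ Finset.Icc 1 (L k), lam i)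
    (hQ5 : (∀ k n : ℕ, ∑ i ∈ Finset.Icc (E k + 1) (E k + n), ε i ≤ 1 / ((k : ℝ) + 1)) ∨
      (∀ k n : ℕ, E k ≤ n → ε n / lam n ≤ 1 / ((k : ℝ) + 1)))
    {d₀ d₁ d₂ : ℕ} (hd₂pos : 0 < d₂)
    (hd₁ : ∑ i ∈ Finset.range (E 0 + 1), ε i + 1 ≤ (d₁ : ℝ))
    (hd₂ : ∀ i, i ≤ E 0 → s i ≤ (d₂ : ℝ)) (k : ℕ) {n : ℕ}
    (hn : Theta L E d₀ d₁ d₂ k ≤ n) : s n ≤ 1 / ((k : ℝ) + 1) := by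
  set d := max (2 * d₀ + d₁) d₂ with hd
  have hdpos : 0 < d := lt_of_lt_of_le hd₂pos (le_max_right _ _)
  have hdpos' : (0 : ℝ) < d := by exact_mod_cast hdpos
  have hd1 : (d₁ : ℝ) ≤ d := by exact_mod_cast (by omega : d₁ ≤ d)
  have hd2 : (d₂ : ℝ) ≤ d := by exact_mod_cast le_max_right _ _
  set N := E (3 * k + 2) with hN
  have hE0 : E 0 ≤ N := hE (Nat.zero_le _)
  have hthird : 1 / (((3 * k + 2 : ℕ) : ℝ) + 1) = 1 / (3 * ((k : ℝ) + 1)) := by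
    push_cast
    ring
  have hn' : L (N + ⌈Real.log (3 * (d : ℝ) * ((k : ℝ) + 1))⌉₊) + 1 ≤ n := hn
  have hNn : N + 1 ≤ n := by
    have := le_rate hl1 hQ3 (N + ⌈Real.log (3 * (d : ℝ) * ((k : ℝ) + 1))⌉₊)
    omega
  have hexp := exp_neg_sum_le (fun j => (hl0 j).le) hl1 hQ3 (N := N) (N' := N + 1) le_rfl
    (X := 3 * (d : ℝ) * ((k : ℝ) + 1)) (by positivity) hn'
  have hexp' : Real.exp (-∑ j ∈ Finset.Ico (N + 1) n, lam j) * d ≤ 1 / (3 * ((k : ℝ) + 1)) := by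
    calc _ ≤ 1 / (3 * (d : ℝ) * ((k : ℝ) + 1)) * d := by gcongr
      _ = 1 / (3 * ((k : ℝ) + 1)) := by field_simp
  have hfin : 1 / (3 * ((k : ℝ) + 1)) + 1 / (3 * ((k : ℝ) + 1)) ≤ 1 / ((k : ℝ) + 1) := by
    have e : 1 / (3 * ((k : ℝ) + 1)) = 1 / 3 * (1 / ((k : ℝ) + 1)) := by field_simp
    have : 0 ≤ 1 / ((k : ℝ) + 1) := by positivity
    rw [e]
    linarith
  rcases hQ5 with hQ | hQ
  · have hsN : s (N + 1) ≤ d := by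
      have hsum : ∀ m, s m ≤ ∑ i ∈ Finset.range m, ε i := by
        intro m
        induction m with
        | zero => simp [hsz]
        | succ m ih =>
          rw [Finset.sum_range_succ]
          have := hs m
          have := mul_nonneg (hl0 m).le (hs0 m)
          linarith
      have h1 := Finset.sum_range_add_sum_Ico ε (show E 0 + 1 ≤ N + 1 by omega)
      have h2 := hQ 0 (N - E 0)
      rw [show E 0 + (N - E 0) = N by omega, ← Finset.Ico_add_one_right_eq_Icc] at h2
      have h3 := hsum (N + 1)
      norm_num at h2
      linarith
    have h := le_exp_neg_sum_mul_add (s := s) (v := ε) (b := 0) hNn (fun j => (hl0 j).le) hl1 hε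
      hdpos'.le le_rfl hsN (fun j _ _ => by simpa using hs j)
    have h2 := hQ (3 * k + 2) (n - 1 - N)
    rw [← hN, show N + (n - 1 - N) = n - 1 by omega, ← Finset.Ico_add_one_right_eq_Icc,
      show n - 1 + 1 = n by omega, hthird] at h2
    linarith
  · have hεlam : ∀ k n : ℕ, E k ≤ n → ε n ≤ lam n * (1 / ((k : ℝ) + 1)) := fun k n h => by
      have := (div_le_iff₀ (hl0 n)).1 (hQ k n h)
      linarith
    have hsd : ∀ m, s m ≤ d := by
      intro m
      rcases le_total m (E 0) with hm | hm
      · exact (hd₂ m hm).trans hd2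
      · induction m, hm using Nat.le_induction with
        | base => exact (hd₂ _ le_rfl).trans hd2
        | succ m hm ih =>
          have h1 := hs m
          have h2 := hεlam 0 m hm
          have h3 : (1 : ℝ) ≤ d := by exact_mod_cast hdpos
          have h4 := mul_le_mul_of_nonneg_left ih (sub_nonneg.2 (hl1 m))
          have h5 := mul_le_mul_of_nonneg_left h3 (hl0 m).le
          norm_num at h2
          linarith
    have h := le_exp_neg_sum_mul_add (s := s) (v := 0) (b := 1 / (3 * ((k : ℝ) + 1))) hNn
      (fun j => (hl0 j).le) hl1 (fun _ => le_rfl) hdpos'.le (by positivity) (hsd _)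
      (fun j hj _ => by
        have h1 := hs j
        have h2 := hεlam (3 * k + 2) j (by omega)
        rw [hthird] at h2
        simp only [Pi.zero_apply]
        linarith)
    simp only [Pi.zero_apply, Finset.sum_const_zero] at h
    linarith

end Perturbation

end MPPA

/-! ### Metastability of the inexact iteration -/

theorem mainTheorem2
    {H : Type*} [NormedAddCommGroup H] [InnerProductSpace ℝ H] [CompleteSpace H]
    (A : H → Set H) (hA : MPPA.IsMaximalMonotoneOp A)
    -- the parameters of the algorithm
    (lam gam del cs : ℕ → ℝ)
    (hcs : ∀ n, 0 < cs n)
    (hlam : ∀ n, lam n ∈ Set.Ioo (0 : ℝ) 1)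
    (hdel : ∀ n, del n ∈ Set.Ioo (0 : ℝ) 1)
    (hgam : ∀ n, gam n ∈ Set.Ico (0 : ℝ) 1)
    (hsum : ∀ n, lam n + gam n + del n = 1)
    -- the inexact iteration `z` and the exact iteration `y` with the same starting point
    (u : H) (e z y : ℕ → H)
    (hz : MPPA.IsIteration A u lam gam del cs e z)
    (hy : MPPA.IsIteration A u lam gam del cs 0 y)
    (hyz : y 0 = z 0)
    -- the quantitative conditions
    (c : ℕ) (hc : 0 < c) (h l L E : ℕ → ℕ)
    (hhpos : ∀ n, 0 < h n)
    (hhmono : Monotone h) (hlmono : Monotone l) (hLmono : Monotone L) (hEmono : Monotone E)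
    (hQ1 : ∀ n, 1 / (h n : ℝ) ≤ lam n)
    (hQ2 : ∀ k n : ℕ, l k ≤ n → lam n ≤ 1 / ((k : ℝ) + 1))
    (hQ3 : ∀ k : ℕ, (k : ℝ) ≤ ∑ i ∈ Finset.Icc 1 (L k), lam i)
    (hQ4 : ∀ n, 1 / (c : ℝ) ≤ min (cs n) (del n ^ 2))
    (hQ5 :
      (∀ k n : ℕ, ∑ i ∈ Finset.Icc (E k + 1) (E k + n), ‖e i‖ ≤ 1 / ((k : ℝ) + 1)) ∨
      (∀ k n : ℕ, E k ≤ n → ‖e n‖ / lam n ≤ 1 / ((k : ℝ) + 1)))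
    -- the constants
    (D : ℕ) (hDpos : 0 < D)
    (hD : ∃ p ∈ MPPA.zeros A, max (2 * ‖u - p‖) ‖z 0 - p‖ ≤ (D : ℝ))
    (C : ℕ → ℕ) (hCmono : Monotone C) (hC : ∀ n, cs n ≤ (C n : ℝ))
    (d₀ d₁ d₂ : ℕ) (hd₀pos : 0 < d₀) (hd₁pos : 0 < d₁) (hd₂pos : 0 < d₂)
    (hd₀ : ∃ p ∈ MPPA.zeros A, max ‖u - p‖ ‖z 0 - p‖ ≤ (d₀ : ℝ))
    (hd₁ : ∑ i ∈ Finset.range (E 0 + 1), ‖e i‖ + 1 ≤ (d₁ : ℝ))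
    (hd₂ : ∀ i, i ≤ E 0 → ‖z i - y i‖ ≤ (d₂ : ℝ)) :
    ∀ (k : ℕ) (f : ℕ → ℕ), Monotone f →
      ∃ n ≤ MPPA.nu c C l L h E D d₀ d₁ d₂ k f,
        ∀ i ∈ Set.Icc n (f n), ∀ j ∈ Set.Icc n (f n),
          ‖z i - z j‖ ≤ 1 / ((k : ℝ) + 1) := by
  intro k f hf
  have hlam0 : ∀ n, 0 < lam n := fun n => (hlam n).1
  have hlam1 : ∀ n, lam n ≤ 1 := fun n => (hlam n).2.le
  have hdel0 : ∀ n, 0 ≤ del n := fun n => (hdel n).1.le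
  have hgam0 : ∀ n, 0 ≤ gam n := fun n => (hgam n).1
  obtain ⟨p, hp, hpD⟩ := hD
  set T := MPPA.Theta L E d₀ d₁ d₂ (3 * k + 2) with hT
  set f' := MPPA.fHat L E d₀ d₁ d₂ k f with hf'
  have hf'mono : Monotone f' := fun a b hab => hf (max_le_max hab le_rfl)
  obtain ⟨x, n, hn, hx⟩ := MPPA.exists_mu_norm_sub_sq_le hA hlam0 hlam1 hdel0
    (fun n => (hdel n).2.le) hgam0 hsum hy hc hhpos hhmono hlmono hLmono hQ1 hQ2 hQ3
    (fun n => (hQ4 n).trans (min_le_left _ _))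
    -- `δ_n² ≤ δ_n` as `δ_n < 1`
    (fun n => ((hQ4 n).trans (min_le_right _ _)).trans (by nlinarith [(hdel n).1, (hdel n).2]))
    hDpos hp ((le_max_left _ _).trans hpD) (hyz ▸ (le_max_right _ _).trans hpD) hCmono hC
    (36 * (k + 1) ^ 2 - 1) hf'mono
  have hyx : ∀ i ∈ Set.Icc n (f' n), ‖y i - x‖ ≤ 1 / (6 * ((k : ℝ) + 1)) := fun i hi => by
    have h1 := hx i hi
    rw [MPPA.cast_sub_one_add_one (by positivity)] at h1
    refine le_of_sq_le_sq (h1.trans_eq ?_) (by positivity)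
    push_cast
    rw [div_pow, mul_pow]
    norm_num
  have hzy : ∀ i, T ≤ i → ‖z i - y i‖ ≤ 1 / (3 * ((k : ℝ) + 1)) := fun i hi => by
    have h1 := MPPA.le_of_Theta_le (s := fun n => ‖z n - y n‖) (ε := fun n => ‖e n‖)
      (fun _ => norm_nonneg _) (fun _ => norm_nonneg _) hlam0 hlam1
      (hz.norm_sub_succ_le hA hcs hgam0 hdel0 hsum hy) (by simp [hyz]) hEmono hQ3 hQ5 hd₂pos hd₁
      hd₂ (3 * k + 2) hi
    refine h1.trans_eq ?_
    push_cast
    ring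
  refine ⟨max n T, max_le_max hn le_rfl, fun i hi j hj => ?_⟩
  have hzx : ∀ i ∈ Set.Icc (max n T) (f (max n T)), ‖z i - x‖ ≤ 1 / 2 * (1 / ((k : ℝ) + 1)) := by
    intro i hi
    have h1 := hzy i ((le_max_right _ _).trans hi.1)
    have h2 := hyx i ⟨(le_max_left _ _).trans hi.1, hi.2⟩
    have h3 : ‖z i - x‖ ≤ ‖z i - y i‖ + ‖y i - x‖ := norm_sub_le_norm_sub_add_norm_sub _ _ _
    have e : 1 / (3 * ((k : ℝ) + 1)) + 1 / (6 * ((k : ℝ) + 1)) = 1 / 2 * (1 / ((k : ℝ) + 1)) := by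
      field_simp
      norm_num
    linarith
  have := MPPA.norm_sub_le_add (hzx i hi) (hzx j hj)
  linarith
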